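/- **Setting.** Let $0\le a<b$, $J=[a,b]$, $1<\mu<2$, $0\le\nu\le1$, $\xi=\mu+\nu(2-\mu)\in(1,2]$, and let $\varphi\in C^1(J,\mathbb R)$ be increasing with $\varphi'(t)\ne0$ on $J$. Let $C_{2-\xi;\varphi}(J)$ be the space of all $h:(a,b]\to\mathbb R$ such that $(\varphi(t)-\varphi(a))^{2-\xi}h(t)$ extends continuously to $J$, with the norm $\sup_{t\in(a,b]}|(\varphi(t)-\varphi(a))^{2-\xi}h(t)|$. For $\alpha>0$ put $$\mathcal I^{\alpha;\varphi}h(t)=\frac1{\Gamma(\alpha)}\int_a^t\varphi'(s)(\varphi(t)-\varphi(s))^{\alpha-1}h(s)\,ds,$$ and let $\mathcal I^{0;\varphi}$ be the identity. The $\varphi$-Hilfer derivative is $$Dh=\mathcal I^{\nu(2-\mu);\varphi}\Big(\frac1{\varphi'}\frac d{dt}\Big)^2\mathcal I^{(1-\nu)(2-\mu);\varphi}h .$$ It is classical for those $h\in C_{2-\xi;\varphi}(J)$ for which $\big(\frac1{\varphi'}\frac d{dt}\big)^2\mathcal I^{(1-\nu)(2-\mu);\varphi}h$ exists and is continuous on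 $(a,b]$ and is integrable. In general $Dh=g$ on $(a,b]$, for $h\in C_{2-\xi;\varphi}(J)$, means that there are functions $h_n$ with classical derivatives such that $h_n\to h$ and $Dh_n\to g$ in the norm above, i.e. $(\varphi(t)-\varphi(a))^{2-\xi}(h_n-h)(t)\to0$ and $(\varphi(t)-\varphi(a))^{2-\xi}(Dh_n-g)(t)\to0$ uniformly on $(a,b]$ ($D$ is the closure of the classical operator). Finally $E_\mu(z)=\sum_{k\ge0}z^k/\Gamma(k\mu+1)$. **Hypotheses.** (i) (H1): $f:(a,b]\times\mathbb R\times\mathbb R\to\mathbb R$ is continuous; $f(\cdot,y(\cdot),Dy(\cdot))\in C_{2-\xi;\varphi}(J)$ for every $y\in C_{2-\xi;\varphi}(J)$ that has a derivative $Dy\in C_{2-\xi;\varphi}(J)$; and there are $K>0$ and $0<L<1$ with $|f(t,x_1,y_1)-f(t,x_2,y_2)|\le K|x_1-x_2|+L|y_1-y_2|$ for all $t\in(a,b]$ and all $x_1,x_2,y_1,y_2\in\mathbb R$. (ii) $\lambda_i\in\mathbb R$, $\delta_i>0$ $(i=1,\dots,m)$ and $a\le\tau_1<\dots<\tau_m\le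 b$ are such that $$\Lambda=\frac{(\varphi(b)-\varphi(a))^{\xi-1}}{\Gamma(\xi)}-\sum_{i=1}^m\frac{\lambda_i}{\Gamma(\xi+\delta_i)}(\varphi(\tau_i)-\varphi(a))^{\xi+\delta_i-1}\ne0,$$ and, with $\Omega=\sum_{i=1}^m\frac{\lambda_i(\varphi(b)-\varphi(a))^{\delta_i}}{\Gamma(\xi+\mu+\delta_i-1)}+\frac1{\Gamma(\xi+\mu-1)}$, $$\sigma=\frac{K\,\Gamma(\xi-1)(\varphi(b)-\varphi(a))^\mu}{1-L}\left\{\frac{(\varphi(b)-\varphi(a))^{\xi-1}}{\Gamma(\xi)\Lambda}\,\Omega+\frac1{\Gamma(\xi+\mu-1)}\right\}<1 .$$ (iii) $\chi:J\to[0,\infty)$ is continuous and nondecreasing, and $K^*>0$ satisfies $\mathcal I^{\mu;\varphi}\chi(t)\le K^*\chi(t)$ for all $t\in J$. **Conclusion.** The equation $$Dy(t)=f(t,y(t),Dy(t)),\qquad t\in(a,b],\tag{1}$$ is Ulam–Hyers–Rassias stable with respect to $\chi$, with the constant $$C_{f,\chi}=\frac{K^*}{1-L}\,(\varphi(b)-\varphi(a))^{2-\xi}\,E_\mu\!\left(\frac{K}{1-L}(\varphi(b)-\varphi(a))^\mu\right)>0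 .$$ That is, for every $\varepsilon>0$ and every $z\in C_{2-\xi;\varphi}(J)$ having a derivative $Dz$ with $|Dz(t)-f(t,z(t),Dz(t))|\le\varepsilon\chi(t)$ on $(a,b]$ there is a solution $y\in C_{2-\xi;\varphi}(J)$ of (1) with $$\big|(\varphi(t)-\varphi(a))^{2-\xi}(z(t)-y(t))\big|\le\varepsilon\,C_{f,\chi}\,\chi(t),\qquad t\in(a,b].$$ With the same constant, (1) is generalized Ulam–Hyers–Rassias stable: for every $z\in C_{2-\xi;\varphi}(J)$ having a derivative $Dz$ with $|Dz(t)-f(t,z(t),Dz(t))|\le\chi(t)$ on $(a,b]$ there is a solution $y\in C_{2-\xi;\varphi}(J)$ of (1) with $|(\varphi(t)-\varphi(a))^{2-\xi}(z(t)-y(t))|\le C_{f,\chi}\,\chi(t)$ on $(a,b]$. -/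

import Mathlib

open Set Filter Topology MeasureTheory

noncomputable section

namespace PhiHilfer

/-- `ξ = μ + ν (2 - μ)`. -/
def xi (μ ν : ℝ) : ℝ := μ + ν * (2 - μ)

/-- The derivative of `φ` on the interval `J = [a, b]` (one-sided at the end points). -/
def dphi (φ : ℝ → ℝ) (a b : ℝ) (t : ℝ) : ℝ := derivWithin φ (Icc a b) t

/-- The weighted space `C_{γ; φ}(J)` of functions `h` on `(a, b]` (values outside `(a, b]` are
irrelevant): `(φ(t) - φ(a)) ^ γ * h(t)` extends continuously to `[a, b]`. -/
def MemC (φ : ℝ → ℝ) (a b γ : ℝ) (h : ℝ → ℝ) : Prop :=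
  ∃ F : ℝ → ℝ, ContinuousOn F (Icc a b) ∧ ∀ t ∈ Ioc a b, F t = (φ t - φ a) ^ γ * h t

/-- The `φ`-Riemann--Liouville fractional integral of order `α ≥ 0`;
the integral of order `0` is the identity. -/
def rlInt (φ : ℝ → ℝ) (a b α : ℝ) (h : ℝ → ℝ) (t : ℝ) : ℝ :=
  if α = 0 then h t
  else 1 / Real.Gamma α * ∫ s in a..t, dphi φ a b s * (φ t - φ s) ^ (α - 1) * h s

/-- The operator `(1 / φ'(t)) d/dt` on functions on `J` (one-sided derivative at `b`). -/
def phiD (φ : ℝ → ℝ) (a b : ℝ) (F : ℝ → ℝ) (t : ℝ) : ℝ :=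
  derivWithin F (Icc a b) t / dphi φ a b t

/-- The formula of the `φ`-Hilfer derivative of order `μ ∈ (1, 2)` and type `ν ∈ [0, 1]`. -/
def hilferFormula (φ : ℝ → ℝ) (a b μ ν : ℝ) (h : ℝ → ℝ) : ℝ → ℝ :=
  rlInt φ a b (ν * (2 - μ))
    (phiD φ a b (phiD φ a b (rlInt φ a b ((1 - ν) * (2 - μ)) h)))

/-- `h ∈ C_{2-ξ; φ}(J)` has a classical `φ`-Hilfer derivative on `(a, b]`: the two derivatives in
the formula exist at every point of `(a, b]`, and the second one is continuous on `(a, b]` and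
integrable, so that the outer fractional integral is defined at every point of `(a, b]`. -/
structure HasClassicalHilfer (φ : ℝ → ℝ) (a b μ ν : ℝ) (h : ℝ → ℝ) : Prop where
  mem : MemC φ a b (2 - xi μ ν) h
  diff₁ : ∀ t ∈ Ioc a b,
    DifferentiableWithinAt ℝ (rlInt φ a b ((1 - ν) * (2 - μ)) h) (Icc a b) t
  diff₂ : ∀ t ∈ Ioc a b,
    DifferentiableWithinAt ℝ (phiD φ a b (rlInt φ a b ((1 - ν) * (2 - μ)) h)) (Icc a b) t
  cont : ContinuousOn
    (phiD φ a b (phiD φ a b (rlInt φ a b ((1 - ν) * (2 - μ)) h))) (Ioc a b)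
  integrable : IntegrableOn
    (phiD φ a b (phiD φ a b (rlInt φ a b ((1 - ν) * (2 - μ)) h))) (Ioc a b)

/-- Convergence in the norm of `C_{γ; φ}(J)`, that is, in the supremum over `(a, b]` of
`(φ(t) - φ(a)) ^ γ * |h n t - h t|`. -/
def TendstoC (φ : ℝ → ℝ) (a b γ : ℝ) (hn : ℕ → ℝ → ℝ) (h : ℝ → ℝ) : Prop :=
  TendstoUniformlyOn (fun n t => (φ t - φ a) ^ γ * hn n t) (fun t => (φ t - φ a) ^ γ * h t)
    atTop (Ioc a b)

/-- `g` is the `φ`-Hilfer derivative of `h ∈ C_{2-ξ; φ}(J)` on `(a, b]`. The derivative on the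
space is the closure, in the norm of the space, of the operator given by the classical formula:
there are `hn n` with classical `φ`-Hilfer derivatives such that `hn n → h` and the derivatives
of `hn n` converge to `g`. -/
def IsHilferDeriv (φ : ℝ → ℝ) (a b μ ν : ℝ) (h g : ℝ → ℝ) : Prop :=
  MemC φ a b (2 - xi μ ν) h ∧
  ∃ hn : ℕ → ℝ → ℝ, (∀ n, HasClassicalHilfer φ a b μ ν (hn n)) ∧
    TendstoC φ a b (2 - xi μ ν) hn h ∧
    TendstoC φ a b (2 - xi μ ν) (fun n => hilferFormula φ a b μ ν (hn n)) g

/-- Where the classical derivative exists, it is the derivative. -/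
theorem HasClassicalHilfer.isHilferDeriv {φ : ℝ → ℝ} {a b μ ν : ℝ} {h : ℝ → ℝ}
    (H : HasClassicalHilfer φ a b μ ν h) :
    IsHilferDeriv φ a b μ ν h (hilferFormula φ a b μ ν h) :=
  ⟨H.mem, fun _ => h, fun _ => H,
    fun _ hu => Eventually.of_forall fun _ _ _ => refl_mem_uniformity hu,
    fun _ hu => Eventually.of_forall fun _ _ _ => refl_mem_uniformity hu⟩

/-- The one-parameter Mittag-Leffler function. -/
def mittagLeffler (μ z : ℝ) : ℝ := ∑' k : ℕ, z ^ k / Real.Gamma (k * μ + 1)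

/-- The constant `Λ` of the nonlocal boundary condition `y(b) = ∑ λᵢ I^{δᵢ; φ} y(τᵢ)`. -/
def Lam (φ : ℝ → ℝ) (a b μ ν : ℝ) {m : ℕ} (lam δ τ : Fin m → ℝ) : ℝ :=
  (φ b - φ a) ^ (xi μ ν - 1) / Real.Gamma (xi μ ν) -
    ∑ i, lam i / Real.Gamma (xi μ ν + δ i) * (φ (τ i) - φ a) ^ (xi μ ν + δ i - 1)

/-- The constant `Ω`. -/
def Omeg (φ : ℝ → ℝ) (a b μ ν : ℝ) {m : ℕ} (lam δ : Fin m → ℝ) : ℝ :=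
  ∑ i, lam i * (φ b - φ a) ^ δ i / Real.Gamma (xi μ ν + μ + δ i - 1) +
    1 / Real.Gamma (xi μ ν + μ - 1)

/-- The constant `σ`. -/
def sigm (φ : ℝ → ℝ) (a b μ ν : ℝ) {m : ℕ} (lam δ τ : Fin m → ℝ) (K L : ℝ) : ℝ :=
  K * Real.Gamma (xi μ ν - 1) * (φ b - φ a) ^ μ / (1 - L) *
    ((φ b - φ a) ^ (xi μ ν - 1) / (Real.Gamma (xi μ ν) * Lam φ a b μ ν lam δ τ) *
        Omeg φ a b μ ν lam δ +
      1 / Real.Gamma (xi μ ν + μ - 1))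

/-- Hypothesis (H1): `f` is continuous on `(a, b] × ℝ × ℝ`; `f(·, y, Dy)` belongs to
`C_{2-ξ; φ}(J)` for every `y` in this space that has a `φ`-Hilfer derivative `Dy` in this space;
and `f` is Lipschitz with constants `K > 0` and `0 < L < 1`. -/
structure HypH1 (φ : ℝ → ℝ) (a b μ ν : ℝ) (f : ℝ → ℝ → ℝ → ℝ) (K L : ℝ) : Prop where
  cont : ContinuousOn (fun p : ℝ × ℝ × ℝ => f p.1 p.2.1 p.2.2) (Ioc a b ×ˢ univ)
  mapsTo : ∀ y g : ℝ → ℝ, IsHilferDeriv φ a b μ ν y g → MemC φ a b (2 - xi μ ν) g →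
    MemC φ a b (2 - xi μ ν) (fun t => f t (y t) (g t))
  K_pos : 0 < K
  L_pos : 0 < L
  L_lt_one : L < 1
  lipschitz : ∀ t ∈ Ioc a b, ∀ x₁ x₂ y₁ y₂ : ℝ,
    |f t x₁ y₁ - f t x₂ y₂| ≤ K * |x₁ - x₂| + L * |y₁ - y₂|

/-- `y ∈ C_{2-ξ; φ}(J)` solves the implicit equation `Dy(t) = f(t, y(t), Dy(t))` on `(a, b]`. -/
def IsSolution (φ : ℝ → ℝ) (a b μ ν : ℝ) (f : ℝ → ℝ → ℝ → ℝ) (y : ℝ → ℝ) : Prop :=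
  ∃ g : ℝ → ℝ, IsHilferDeriv φ a b μ ν y g ∧ ∀ t ∈ Ioc a b, g t = f t (y t) (g t)

/-- `z ∈ C_{2-ξ; φ}(J)` solves the inequality `|Dz(t) - f(t, z(t), Dz(t))| ≤ ρ(t)` on `(a, b]`. -/
def IsApproxSolution (φ : ℝ → ℝ) (a b μ ν : ℝ) (f : ℝ → ℝ → ℝ → ℝ) (ρ z : ℝ → ℝ) : Prop :=
  ∃ g : ℝ → ℝ, IsHilferDeriv φ a b μ ν z g ∧ ∀ t ∈ Ioc a b, |g t - f t (z t) (g t)| ≤ ρ t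

/-- Ulam--Hyers--Rassias stability of the implicit equation with respect to `χ`,
with the constant `C > 0`. -/
def UHRStableWith (φ : ℝ → ℝ) (a b μ ν : ℝ) (f : ℝ → ℝ → ℝ → ℝ) (χ : ℝ → ℝ) (C : ℝ) : Prop :=
  0 < C ∧ ∀ ε : ℝ, 0 < ε → ∀ z : ℝ → ℝ,
    IsApproxSolution φ a b μ ν f (fun t => ε * χ t) z →
    ∃ y : ℝ → ℝ, IsSolution φ a b μ ν f y ∧
      ∀ t ∈ Ioc a b, |(φ t - φ a) ^ (2 - xi μ ν) * (z t - y t)| ≤ ε * C * χ t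

/-- Generalized Ulam--Hyers--Rassias stability of the implicit equation with respect to `χ`,
with the constant `C > 0`. -/
def GenUHRStableWith (φ : ℝ → ℝ) (a b μ ν : ℝ) (f : ℝ → ℝ → ℝ → ℝ) (χ : ℝ → ℝ) (C : ℝ) : Prop :=
  0 < C ∧ ∀ z : ℝ → ℝ, IsApproxSolution φ a b μ ν f χ z →
    ∃ y : ℝ → ℝ, IsSolution φ a b μ ν f y ∧
      ∀ t ∈ Ioc a b, |(φ t - φ a) ^ (2 - xi μ ν) * (z t - y t)| ≤ C * χ t

end PhiHilfer

end

/-!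
# Ulam--Hyers--Rassias stability of an implicit `φ`-Hilfer equation

Write `γ = 2 - ξ = (1 - ν) (2 - μ)`, so that `0 ≤ γ < 1`, and let `I^α` be the fractional integral
`rlInt φ a b α`. The stability estimate rests on an exact description of the pairs `(h, g)` such
that `g` is the `φ`-Hilfer derivative of `h`: these satisfy
`h = p * (φ - φ(a)) ^ (-γ) + q * (φ - φ(a)) ^ (1 - γ) + I^μ g` for some constants `p`, `q`
(`IsHilferDeriv.integrableOn_and_repr`), and, for `g` in the weighted space, each function of this
form has the derivative `g` (`IsTimeChange.isHilferDeriv_fracPow_add_rlInt`).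

* The first statement is proved for classical derivatives with the semigroup property
  `I^α I^β = I^(α + β)` (`IsTimeChange.rlInt_rlInt`, by Fubini's theorem and the Beta integral),
  and then passes to the closure, as weighted uniform convergence of derivatives gives convergence
  of their integrals, and a limit of affine functions of `φ` is affine in `φ`.
* For the second one, the weighted function `(φ - φ(a)) ^ γ * g` is approximated uniformly by
  polynomials in `φ - φ(a)`, for which all the fractional integrals and derivatives are explicit.

Given an approximate solution `z = c + I^μ g` with singular part `c`, the exact solution `y` is the
one with the same singular part: `y = c + I^μ k` with `k = f(·, c + I^μ k, k)`. Such a `k` exists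
by the contraction principle, applied in the weighted space with the additional exponential weight
`exp (θ (φ - φ(a)) ^ (1 - γ))` (`HypH1.exists_eq`). The Lipschitz condition gives
`|g - k| ≤ (ε χ + K |z - y|) / (1 - L)`, hence
`|z - y| ≤ ε K* χ / (1 - L) + K / (1 - L) * I^μ |z - y|`, and the fractional Grönwall inequality
`IsTimeChange.le_mul_mittagLeffler` yields the constant.
-/

namespace PhiHilfer

/-! ### Change of variable and the Beta integral -/

/-- `φ` is an admissible change of the time variable on `[a, b]`: strictly increasing and `C¹`,
with positive derivative. -/
structure IsTimeChange (φ : ℝ → ℝ) (a b : ℝ) : Prop where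
  lt : a < b
  cont : ContinuousOn φ (Icc a b)
  mono : StrictMonoOn φ (Icc a b)
  deriv : ∀ t ∈ Icc a b, HasDerivWithinAt φ (dphi φ a b t) (Icc a b) t
  cont_deriv : ContinuousOn (dphi φ a b) (Icc a b)
  pos : ∀ t ∈ Icc a b, 0 < dphi φ a b t

theorem isTimeChange_of_contDiffOn {φ : ℝ → ℝ} {a b : ℝ} (hab : a < b)
    (hφ : ContDiffOn ℝ 1 φ (Icc a b)) (hmono : StrictMonoOn φ (Icc a b))
    (h0 : ∀ t ∈ Icc a b, dphi φ a b t ≠ 0) : IsTimeChange φ a b where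
  lt := hab
  cont := hφ.continuousOn
  mono := hmono
  deriv t ht := ((hφ.differentiableOn one_ne_zero) t ht).hasDerivWithinAt
  cont_deriv := hφ.continuousOn_derivWithin (uniqueDiffOn_Icc hab) le_rfl
  pos t ht := lt_of_le_of_ne hmono.monotoneOn.derivWithin_nonneg (h0 t ht).symm

/-- Euler's Beta integral on an arbitrary interval. -/
theorem integral_rpow_mul_rpow {x y α β : ℝ} (hxy : x < y) (hα : 0 < α) (hβ : 0 < β) :
    ∫ s in Ioc x y, (y - s) ^ (α - 1) * (s - x) ^ (β - 1) =
      Real.Gamma α * Real.Gamma β / Real.Gamma (α + β) * (y - x) ^ (α + β - 1) := by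
  have hpos : 0 < y - x := sub_pos.2 hxy
  have h1 := Complex.betaIntegral_scaled (β : ℂ) (α : ℂ) hpos
  rw [Complex.betaIntegral_eq_Gamma_mul_div _ _ (by simpa) (by simpa)] at h1
  have h2 : ∫ s in (0 : ℝ)..(y - x), s ^ (β - 1) * ((y - x) - s) ^ (α - 1) =
      (y - x) ^ (β + α - 1) *
        (Real.Gamma β * Real.Gamma α / Real.Gamma (β + α)) := by
    have h3 : ((∫ s in (0 : ℝ)..(y - x), s ^ (β - 1) * ((y - x) - s) ^ (α - 1) : ℝ) : ℂ) =
        ∫ s in (0 : ℝ)..(y - x), (s : ℂ) ^ ((β : ℂ) - 1) *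
          (((y - x : ℝ) : ℂ) - s) ^ ((α : ℂ) - 1) := by
      rw [← intervalIntegral.integral_ofReal]
      refine intervalIntegral.integral_congr fun s hs => ?_
      rw [uIcc_of_le hpos.le] at hs
      have e1 : ((β : ℂ) - 1) = ((β - 1 : ℝ) : ℂ) := by push_cast; ring
      have e2 : ((α : ℂ) - 1) = ((α - 1 : ℝ) : ℂ) := by push_cast; ring
      have e3 : (((y - x : ℝ) : ℂ) - s) = ((y - x - s : ℝ) : ℂ) := by push_cast; ring
      rw [e1, e2, e3, ← Complex.ofReal_cpow hs.1, ← Complex.ofReal_cpow (by linarith [hs.2])]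
      push_cast; ring
    have e4 : ((β : ℂ) + α - 1) = ((β + α - 1 : ℝ) : ℂ) := by push_cast; ring
    rw [← h3, e4, ← Complex.ofReal_cpow hpos.le, Complex.Gamma_ofReal, Complex.Gamma_ofReal,
      ← Complex.ofReal_add, Complex.Gamma_ofReal] at h1
    exact_mod_cast h1
  rw [← intervalIntegral.integral_of_le hxy.le]
  have h4 := intervalIntegral.integral_comp_sub_right (a := x) (b := y)
    (fun s => s ^ (β - 1) * ((y - x) - s) ^ (α - 1)) x
  rw [sub_self] at h4
  rw [show (∫ s in x..y, (y - s) ^ (α - 1) * (s - x) ^ (β - 1)) =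
    ∫ s in x..y, (s - x) ^ (β - 1) * (y - x - (s - x)) ^ (α - 1) from ?_, h4, h2]
  · rw [add_comm β α]; ring
  · refine intervalIntegral.integral_congr fun s _ => ?_
    rw [show y - x - (s - x) = y - s by ring, mul_comm]

namespace IsTimeChange

variable {φ : ℝ → ℝ} {a b : ℝ} (H : IsTimeChange φ a b)
include H

theorem sub_pos {s t : ℝ} (hs : a ≤ s) (hst : s < t) (ht : t ≤ b) : 0 < φ t - φ s :=
  _root_.sub_pos.2 (H.mono ⟨hs, hst.le.trans ht⟩ ⟨hs.trans hst.le, ht⟩ hst)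

theorem sub_nonneg {s t : ℝ} (hs : a ≤ s) (hst : s ≤ t) (ht : t ≤ b) : 0 ≤ φ t - φ s :=
  _root_.sub_nonneg.2 (H.mono.monotoneOn ⟨hs, hst.trans ht⟩ ⟨hs.trans hst, ht⟩ hst)

theorem sub_pos_of_mem {t : ℝ} (ht : t ∈ Ioc a b) : 0 < φ t - φ a :=
  H.sub_pos le_rfl ht.1 ht.2

theorem sub_le {s t : ℝ} (hs : a ≤ s) (hst : s ≤ t) (ht : t ≤ b) : φ t - φ s ≤ φ b - φ a := by
  have h1 := H.sub_nonneg le_rfl hs (hst.trans ht)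
  have h2 := H.sub_nonneg (hs.trans hst) ht le_rfl
  linarith

theorem cont_sub : ContinuousOn (fun t => φ t - φ a) (Icc a b) := H.cont.sub continuousOn_const

theorem image_Ioc {r t : ℝ} (hr : a ≤ r) (hrt : r ≤ t) (ht : t ≤ b) :
    φ '' Ioc r t = Ioc (φ r) (φ t) := by
  refine Subset.antisymm ?_
    (intermediate_value_Ioc hrt (H.cont.mono (Icc_subset_Icc hr ht)))
  rintro _ ⟨s, hs, rfl⟩
  exact ⟨by linarith [H.sub_pos hr hs.1 (hs.2.trans ht)],
    by linarith [H.sub_nonneg (hr.trans hs.1.le) hs.2 ht]⟩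

theorem setIntegral_comp {r t : ℝ} (hr : a ≤ r) (hrt : r ≤ t) (ht : t ≤ b) (g : ℝ → ℝ) :
    ∫ s in Ioc r t, dphi φ a b s * g (φ s) = ∫ x in Ioc (φ r) (φ t), g x := by
  have hsub : Ioc r t ⊆ Icc a b := fun s hs => ⟨hr.trans hs.1.le, hs.2.trans ht⟩
  rw [← H.image_Ioc hr hrt ht, integral_image_eq_integral_deriv_smul_of_monotoneOn
    measurableSet_Ioc (fun s hs => (H.deriv s (hsub hs)).mono hsub)
    (H.mono.monotoneOn.mono hsub)]
  rfl

/-- The Beta integral in the variable `φ`. -/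
theorem integral_kernel {r t α β : ℝ} (hr : a ≤ r) (hrt : r < t) (ht : t ≤ b) (hα : 0 < α)
    (hβ : 0 < β) :
    ∫ s in Ioc r t, dphi φ a b s * ((φ t - φ s) ^ (α - 1) * (φ s - φ r) ^ (β - 1)) =
      Real.Gamma α * Real.Gamma β / Real.Gamma (α + β) * (φ t - φ r) ^ (α + β - 1) := by
  rw [H.setIntegral_comp hr hrt.le ht (fun x => (φ t - x) ^ (α - 1) * (x - φ r) ^ (β - 1)),
    integral_rpow_mul_rpow (by linarith [H.sub_pos hr hrt ht]) hα hβ]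

theorem integral_kernel_pos {r t α β : ℝ} (hr : a ≤ r) (hrt : r < t) (ht : t ≤ b) (hα : 0 < α)
    (hβ : 0 < β) :
    0 < ∫ s in Ioc r t, dphi φ a b s * ((φ t - φ s) ^ (α - 1) * (φ s - φ r) ^ (β - 1)) := by
  rw [H.integral_kernel hr hrt ht hα hβ]
  have := H.sub_pos hr hrt ht
  have := Real.Gamma_pos_of_pos hα
  have := Real.Gamma_pos_of_pos hβ
  have := Real.Gamma_pos_of_pos (add_pos hα hβ)
  positivity

theorem integrableOn_kernel {r t α β : ℝ} (hr : a ≤ r) (hrt : r < t) (ht : t ≤ b) (hα : 0 < α)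
    (hβ : 0 < β) :
    IntegrableOn (fun s => dphi φ a b s * ((φ t - φ s) ^ (α - 1) * (φ s - φ r) ^ (β - 1)))
      (Ioc r t) := by
  -- A function whose Bochner integral is not the junk value `0` is integrable.
  by_contra h
  exact (H.integral_kernel_pos hr hrt ht hα hβ).ne' (integral_undef h)

end IsTimeChange

theorem rlInt_zero {φ : ℝ → ℝ} {a b : ℝ} (h : ℝ → ℝ) : rlInt φ a b 0 h = h := by
  funext t; simp [rlInt]

theorem rlInt_of_pos {φ : ℝ → ℝ} {a b α t : ℝ} (hα : 0 < α) (ht : a ≤ t) (h : ℝ → ℝ) :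
    rlInt φ a b α h t =
      1 / Real.Gamma α * ∫ s in Ioc a t, dphi φ a b s * (φ t - φ s) ^ (α - 1) * h s := by
  rw [rlInt, if_neg hα.ne', intervalIntegral.integral_of_le ht]

theorem rlInt_congr {φ : ℝ → ℝ} {a b α t : ℝ} {h k : ℝ → ℝ} (ht : t ∈ Ioc a b)
    (hk : EqOn h k (Ioc a b)) : rlInt φ a b α h t = rlInt φ a b α k t := by
  unfold rlInt
  split_ifs
  · exact hk ht
  · rw [intervalIntegral.integral_of_le ht.1.le, intervalIntegral.integral_of_le ht.1.le]
    congr 1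
    refine setIntegral_congr_fun measurableSet_Ioc fun s hs => ?_
    simp only [hk ⟨hs.1, hs.2.trans ht.2⟩]

/-- The power `(φ - φ(a)) ^ e / Γ(e + 1)`, normalised so that fractional integration and
`phiD` only shift the exponent. As `1 / Γ` is `0` at the poles in Mathlib, the function vanishes
for negative integers `e`. -/
noncomputable def fracPow (φ : ℝ → ℝ) (a e t : ℝ) : ℝ := (φ t - φ a) ^ e / Real.Gamma (e + 1)

namespace IsTimeChange

variable {φ : ℝ → ℝ} {a b : ℝ} (H : IsTimeChange φ a b)
include H

theorem integrableOn_kernel_mul_fracPow {t α e : ℝ} (ht : t ∈ Ioc a b) (hα : 0 < α)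
    (he : -1 < e) :
    IntegrableOn (fun s => dphi φ a b s * (φ t - φ s) ^ (α - 1) * fracPow φ a e s)
      (Ioc a t) := by
  have h := (H.integrableOn_kernel le_rfl ht.1 ht.2 hα (by linarith : 0 < e + 1)).div_const
    (Real.Gamma (e + 1))
  refine h.congr (Eventually.of_forall fun s => ?_)
  simp only [fracPow, add_sub_cancel_right]
  ring

theorem rlInt_fracPow {t α e : ℝ} (ht : t ∈ Ioc a b) (hα : 0 ≤ α) (he : -1 < e) :
    rlInt φ a b α (fracPow φ a e) t = fracPow φ a (e + α) t := by
  rcases hα.eq_or_lt with rfl | hα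
  · rw [rlInt_zero, add_zero]
  have h := H.integral_kernel le_rfl ht.1 ht.2 hα (by linarith : 0 < e + 1)
  have e1 : ∫ s in Ioc a t, dphi φ a b s * (φ t - φ s) ^ (α - 1) * fracPow φ a e s =
      (∫ s in Ioc a t, dphi φ a b s * ((φ t - φ s) ^ (α - 1) * (φ s - φ a) ^ (e + 1 - 1))) /
        Real.Gamma (e + 1) := by
    rw [← integral_div]
    refine integral_congr_ae (Eventually.of_forall fun s => ?_)
    simp only [fracPow, add_sub_cancel_right]
    ring
  rw [rlInt_of_pos hα ht.1.le, e1, h, fracPow]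
  have := (Real.Gamma_pos_of_pos hα).ne'
  have := (Real.Gamma_pos_of_pos (by linarith : 0 < e + 1)).ne'
  rw [show α + (e + 1) - 1 = e + α by ring, show α + (e + 1) = e + α + 1 by ring]
  field_simp

theorem hasDerivWithinAt_fracPow {t : ℝ} (e : ℝ) (ht : t ∈ Ioc a b) :
    HasDerivWithinAt (fracPow φ a e) (dphi φ a b t * fracPow φ a (e - 1) t) (Icc a b) t := by
  have h0 := H.sub_pos_of_mem ht
  have h1 := (((H.deriv t ⟨ht.1.le, ht.2⟩).sub_const (φ a)).rpow_const
    (p := e) (Or.inl h0.ne')).div_const (Real.Gamma (e + 1))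
  refine h1.congr_deriv ?_
  rw [fracPow, sub_add_cancel]
  rcases eq_or_ne e 0 with rfl | he
  · simp [Real.Gamma_zero]
  · rw [Real.Gamma_add_one he]
    field_simp

end IsTimeChange

/-! ### Basic properties of fractional integrals -/

namespace IsTimeChange

variable {φ : ℝ → ℝ} {a b : ℝ} (H : IsTimeChange φ a b)
include H

theorem integrableOn_dphi_mul {g : ℝ → ℝ} (hg : IntegrableOn g (Ioc a b)) :
    IntegrableOn (fun t => dphi φ a b t * g t) (Ioc a b) := by
  rw [← integrableOn_Icc_iff_integrableOn_Ioc] at hg ⊢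
  exact hg.continuousOn_mul H.cont_deriv isCompact_Icc

theorem integrableOn_of_dphi_mul {g : ℝ → ℝ}
    (hg : IntegrableOn (fun t => dphi φ a b t * g t) (Ioc a b)) : IntegrableOn g (Ioc a b) := by
  rw [← integrableOn_Icc_iff_integrableOn_Ioc] at hg
  have h := hg.continuousOn_mul
    (H.cont_deriv.inv₀ fun t ht => (H.pos t ht).ne') isCompact_Icc
  refine IntegrableOn.congr_fun (h.mono_set Ioc_subset_Icc_self) (fun t ht => ?_) measurableSet_Ioc
  have := (H.pos t (Ioc_subset_Icc_self ht)).ne'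
  simp only [Pi.inv_apply]
  field_simp

theorem integrableOn_rpow {e : ℝ} (he : -1 < e) :
    IntegrableOn (fun t => (φ t - φ a) ^ e) (Ioc a b) := by
  apply H.integrableOn_of_dphi_mul
  have h := H.integrableOn_kernel le_rfl H.lt le_rfl one_pos (by linarith : 0 < e + 1)
  simpa using h

theorem integrableOn_fracPow {e : ℝ} (he : -1 < e) :
    IntegrableOn (fracPow φ a e) (Ioc a b) := (H.integrableOn_rpow he).div_const _

theorem continuousOn_rpow_kernel {t α : ℝ} (ht : t ≤ b) (hα : 1 ≤ α) :
    ContinuousOn (fun s => dphi φ a b s * (φ t - φ s) ^ (α - 1)) (Icc a t) := by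
  have hs : Icc a t ⊆ Icc a b := Icc_subset_Icc_right ht
  exact (H.cont_deriv.mono hs).mul
    ((continuousOn_const.sub (H.cont.mono hs)).rpow_const fun x _ => Or.inr (by linarith))

theorem integrableOn_kernel_mul {t α : ℝ} (ht : t ∈ Icc a b) (hα : 1 ≤ α) {g : ℝ → ℝ}
    (hg : IntegrableOn g (Ioc a b)) :
    IntegrableOn (fun s => dphi φ a b s * (φ t - φ s) ^ (α - 1) * g s) (Ioc a t) := by
  have hg' := hg.mono_set (Ioc_subset_Ioc_right ht.2)
  rw [← integrableOn_Icc_iff_integrableOn_Ioc] at hg' ⊢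
  exact hg'.continuousOn_mul (H.continuousOn_rpow_kernel ht.2 hα) isCompact_Icc

theorem rlInt_add {t α : ℝ} (ht : t ∈ Icc a b) (hα : 1 ≤ α) {g k : ℝ → ℝ}
    (hg : IntegrableOn g (Ioc a b)) (hk : IntegrableOn k (Ioc a b)) :
    rlInt φ a b α (fun s => g s + k s) t = rlInt φ a b α g t + rlInt φ a b α k t := by
  have h0 : 0 < α := by linarith
  rw [rlInt_of_pos h0 ht.1, rlInt_of_pos h0 ht.1, rlInt_of_pos h0 ht.1, ← mul_add,
    ← integral_add (H.integrableOn_kernel_mul ht hα hg) (H.integrableOn_kernel_mul ht hα hk)]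
  simp only [mul_add]

theorem rlInt_sub {t α : ℝ} (ht : t ∈ Icc a b) (hα : 1 ≤ α) {g k : ℝ → ℝ}
    (hg : IntegrableOn g (Ioc a b)) (hk : IntegrableOn k (Ioc a b)) :
    rlInt φ a b α (fun s => g s - k s) t = rlInt φ a b α g t - rlInt φ a b α k t := by
  have h0 : 0 < α := by linarith
  rw [rlInt_of_pos h0 ht.1, rlInt_of_pos h0 ht.1, rlInt_of_pos h0 ht.1, ← mul_sub,
    ← integral_sub (H.integrableOn_kernel_mul ht hα hg) (H.integrableOn_kernel_mul ht hα hk)]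
  simp only [mul_sub]

omit H in
theorem rlInt_const_mul (α c t : ℝ) (g : ℝ → ℝ) :
    rlInt φ a b α (fun s => c * g s) t = c * rlInt φ a b α g t := by
  unfold rlInt
  split_ifs
  · rfl
  · rw [mul_left_comm, ← intervalIntegral.integral_const_mul c]
    congr 1
    exact intervalIntegral.integral_congr fun s _ => by ring

/-- Domination for fractional integrals; no measurability of `g` is needed, as the Bochner
integral of a non-integrable function is `0`. -/
theorem abs_rlInt_le {t α : ℝ} (ht : t ∈ Icc a b) (hα : 0 < α) {g G : ℝ → ℝ}
    (hG : IntegrableOn (fun s => dphi φ a b s * (φ t - φ s) ^ (α - 1) * G s) (Ioc a t))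
    (hgG : ∀ s ∈ Ioc a t, |g s| ≤ G s) : |rlInt φ a b α g t| ≤ rlInt φ a b α G t := by
  have hΓ := Real.Gamma_pos_of_pos hα
  rw [rlInt_of_pos hα ht.1, rlInt_of_pos hα ht.1, abs_mul,
    abs_of_pos (by positivity : 0 < 1 / Real.Gamma α)]
  refine mul_le_mul_of_nonneg_left ?_ (by positivity)
  rw [← Real.norm_eq_abs]
  refine norm_integral_le_of_norm_le hG ?_
  refine (ae_restrict_iff' measurableSet_Ioc).2 (Eventually.of_forall fun s hs => ?_)
  have h1 : 0 ≤ dphi φ a b s * (φ t - φ s) ^ (α - 1) :=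
    mul_nonneg (H.pos s ⟨hs.1.le, hs.2.trans ht.2⟩).le
      (Real.rpow_nonneg (H.sub_nonneg hs.1.le hs.2 ht.2) _)
  rw [Real.norm_eq_abs, abs_mul, abs_of_nonneg h1]
  exact mul_le_mul_of_nonneg_left (hgG s hs) h1

theorem rlInt_sum_fracPow {ι : Type*} (S : Finset ι) (A e : ι → ℝ) {t α : ℝ}
    (ht : t ∈ Ioc a b) (hα : 0 ≤ α) (he : ∀ i ∈ S, -1 < e i) :
    rlInt φ a b α (fun s => ∑ i ∈ S, A i * fracPow φ a (e i) s) t =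
      ∑ i ∈ S, A i * fracPow φ a (e i + α) t := by
  rcases hα.eq_or_lt with rfl | hα
  · simp [rlInt_zero]
  simp only [rlInt_of_pos hα ht.1.le, Finset.mul_sum]
  rw [integral_finsetSum]
  · rw [Finset.mul_sum]
    refine Finset.sum_congr rfl fun i hi => ?_
    rw [← H.rlInt_fracPow ht hα.le (he i hi), ← rlInt_const_mul, rlInt_of_pos hα ht.1.le]
  · intro i hi
    refine ((H.integrableOn_kernel_mul_fracPow ht hα (he i hi)).const_mul (A i)).congr
      (Eventually.of_forall fun s => ?_)
    simp only
    ring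

theorem phiD_eq {F : ℝ → ℝ} {t d : ℝ} (ht : t ∈ Ioc a b)
    (h : HasDerivWithinAt F (dphi φ a b t * d) (Icc a b) t) : phiD φ a b F t = d := by
  have ht' : t ∈ Icc a b := Ioc_subset_Icc_self ht
  rw [phiD, h.derivWithin (uniqueDiffOn_Icc H.lt t ht')]
  field_simp [(H.pos t ht').ne']

theorem hasDerivWithinAt_sum_fracPow {ι : Type*} (S : Finset ι) (A e : ι → ℝ) {t : ℝ}
    (ht : t ∈ Ioc a b) :
    HasDerivWithinAt (fun s => ∑ i ∈ S, A i * fracPow φ a (e i) s)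
      (dphi φ a b t * ∑ i ∈ S, A i * fracPow φ a (e i - 1) t) (Icc a b) t := by
  have h := HasDerivWithinAt.fun_sum (u := S) fun i _ =>
    (H.hasDerivWithinAt_fracPow (e i) ht).const_mul (A i)
  refine h.congr_deriv ?_
  rw [Finset.mul_sum]
  exact Finset.sum_congr rfl fun i _ => by ring

omit H in
/-- Functions which agree on `(a, b]` have the same derivatives at points of `(a, b]`. -/
theorem hasDerivWithinAt_congr {F G : ℝ → ℝ} {t d : ℝ} (ht : t ∈ Ioc a b)
    (hFG : EqOn F G (Ioc a b)) (h : HasDerivWithinAt G d (Icc a b) t) :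
    HasDerivWithinAt F d (Icc a b) t := by
  refine h.congr_of_eventuallyEq ?_ (hFG ht)
  filter_upwards [self_mem_nhdsWithin, mem_nhdsWithin_of_mem_nhds (Ioi_mem_nhds ht.1)] with s h1 h2
  exact hFG ⟨h2, h1.2⟩

theorem aemeasurable_phi {s : Set ℝ} (hs : s ⊆ Icc a b) (hm : MeasurableSet s) :
    AEMeasurable φ (volume.restrict s) := (H.cont.mono hs).aemeasurable hm

theorem aemeasurable_dphi {s : Set ℝ} (hs : s ⊆ Icc a b) (hm : MeasurableSet s) :
    AEMeasurable (dphi φ a b) (volume.restrict s) := (H.cont_deriv.mono hs).aemeasurable hm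

/-- Fractional integrals of order greater than `1` of integrable functions are continuous. -/
theorem continuousOn_rlInt {α : ℝ} (hα : 1 < α) {g : ℝ → ℝ} (hg : IntegrableOn g (Ioc a b)) :
    ContinuousOn (rlInt φ a b α g) (Icc a b) := by
  have h0 : 0 < α := by linarith
  -- The kernel is extended by `0` beyond `s = t`, which keeps it continuous in `t`.
  have key : ∀ t ∈ Icc a b, rlInt φ a b α g t = 1 / Real.Gamma α *
      ∫ s in Ioc a b, dphi φ a b s * (max (φ t - φ s) 0) ^ (α - 1) * g s := by
    intro t ht
    rw [rlInt_of_pos h0 ht.1]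
    congr 1
    have hz : ∀ s ∈ Ioc t b, dphi φ a b s * (max (φ t - φ s) 0) ^ (α - 1) * g s = 0 := by
      intro s hs
      have := H.sub_pos ht.1 hs.1 hs.2
      rw [max_eq_right (by linarith), Real.zero_rpow (by linarith)]
      ring
    rw [setIntegral_eq_of_subset_of_forall_sdiff_eq_zero (s := Ioc a t) measurableSet_Ioc
      (Ioc_subset_Ioc_right ht.2)
      (f := fun s => dphi φ a b s * (max (φ t - φ s) 0) ^ (α - 1) * g s)]
    · refine setIntegral_congr_fun measurableSet_Ioc fun s hs => ?_
      rw [max_eq_left (H.sub_nonneg hs.1.le hs.2 ht.2)]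
    · intro s hs
      exact hz s ⟨not_le.1 fun h => hs.2 ⟨hs.1.1, h⟩, hs.1.2⟩
  refine ContinuousOn.congr ?_ key
  refine continuousOn_const.mul ?_
  refine continuousOn_of_dominated
    (bound := fun s => (φ b - φ a) ^ (α - 1) * ‖dphi φ a b s * g s‖) ?_ ?_ ?_ ?_
  · intro t ht
    have m1 := H.aemeasurable_phi Ioc_subset_Icc_self measurableSet_Ioc
    have m2 := H.aemeasurable_dphi Ioc_subset_Icc_self measurableSet_Ioc
    exact ((m2.mul (((m1.const_sub (φ t)).max aemeasurable_const).pow_const _)).mul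
      hg.aestronglyMeasurable.aemeasurable).aestronglyMeasurable
  · intro t ht
    refine (ae_restrict_iff' measurableSet_Ioc).2 (Eventually.of_forall fun s hs => ?_)
    rw [mul_right_comm, norm_mul, mul_comm]
    refine mul_le_mul_of_nonneg_right ?_ (norm_nonneg _)
    rw [Real.norm_eq_abs, abs_of_nonneg (by positivity)]
    refine Real.rpow_le_rpow (le_max_right _ _) ?_ (by linarith)
    have h1 := H.sub_nonneg le_rfl hs.1.le hs.2
    have h2 := H.sub_nonneg ht.1 ht.2 le_rfl
    have h3 := H.sub_nonneg le_rfl H.lt.le le_rfl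
    exact max_le (by linarith) h3
  · exact (H.integrableOn_dphi_mul hg).norm.const_mul _
  · refine Eventually.of_forall fun s => ?_
    refine (continuousOn_const.mul ?_).mul continuousOn_const
    exact ((H.cont.sub continuousOn_const).sup continuousOn_const).rpow_const
      fun x _ => Or.inr (by linarith)

end IsTimeChange

/-! ### Semigroup property -/

/-- The integrand, in the variables `(s, r)`, of the iterated fractional integral of `v` at `t`,
without the factors `1 / Γ`; it is extended by `0` off the triangle `r ≤ s`, so that both integrals
can be taken over `(a, t]`. -/
noncomputable def iterKernel (φ : ℝ → ℝ) (a b α β t : ℝ) (v : ℝ → ℝ) (p : ℝ × ℝ) : ℝ :=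
  {p : ℝ × ℝ | p.2 ≤ p.1}.indicator (fun p =>
    dphi φ a b p.1 * ((φ t - φ p.1) ^ (α - 1) * (φ p.1 - φ p.2) ^ (β - 1)) *
      (dphi φ a b p.2 * v p.2)) p

namespace IsTimeChange

variable {φ : ℝ → ℝ} {a b : ℝ} (H : IsTimeChange φ a b)
include H

omit H in
theorem setIntegral_iterKernel_right {α β t s : ℝ} (v : ℝ → ℝ) (hs : s ∈ Ioc a t) :
    ∫ r in Ioc a t, iterKernel φ a b α β t v (s, r) =
      dphi φ a b s * (φ t - φ s) ^ (α - 1) *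
        ∫ r in Ioc a s, dphi φ a b r * (φ s - φ r) ^ (β - 1) * v r := by
  have h : (fun r => iterKernel φ a b α β t v (s, r)) = (Iic s).indicator (fun r =>
      dphi φ a b s * (φ t - φ s) ^ (α - 1) *
        (dphi φ a b r * (φ s - φ r) ^ (β - 1) * v r)) := by
    funext r
    simp only [iterKernel, indicator, mem_ofPred_eq, mem_Iic]
    split_ifs
    · ring
    · rfl
  have e : Ioc a t ∩ Iic s = Ioc a s := by
    rw [Ioc_inter_Iic, min_eq_right hs.2]
  rw [h, setIntegral_indicator measurableSet_Iic, e, integral_const_mul]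

omit H in
theorem iterKernel_left {α β t r : ℝ} (v : ℝ → ℝ) :
    (fun s => iterKernel φ a b α β t v (s, r)) = (Ici r).indicator (fun s =>
      dphi φ a b s * ((φ t - φ s) ^ (α - 1) * (φ s - φ r) ^ (β - 1)) *
        (dphi φ a b r * v r)) := by
  funext s
  simp only [iterKernel, indicator, mem_ofPred_eq, mem_Ici]

omit H in
theorem Ioc_inter_Ici_eq {r t : ℝ} (hr : r ∈ Ioc a t) : Ioc a t ∩ Ici r = Icc r t := by
  ext s
  simp only [mem_inter_iff, mem_Ioc, mem_Ici, mem_Icc]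
  exact ⟨fun h => ⟨h.2, h.1.2⟩, fun h => ⟨⟨hr.1.trans_le h.1, h.2⟩, h.1⟩⟩

theorem setIntegral_iterKernel_left {α β t r : ℝ} (ht : t ∈ Ioc a b) (hα : 0 < α) (hβ : 0 < β)
    (v : ℝ → ℝ) (hr : r ∈ Ioo a t) :
    ∫ s in Ioc a t, iterKernel φ a b α β t v (s, r) =
      Real.Gamma α * Real.Gamma β / Real.Gamma (α + β) *
        (dphi φ a b r * (φ t - φ r) ^ (α + β - 1) * v r) := by
  rw [iterKernel_left, setIntegral_indicator measurableSet_Ici,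
    Ioc_inter_Ici_eq ⟨hr.1, hr.2.le⟩, integral_mul_const, integral_Icc_eq_integral_Ioc,
    H.integral_kernel hr.1.le hr.2 ht.2 hα hβ]
  ring

theorem setIntegral_norm_iterKernel_left {α β t r : ℝ} (ht : t ∈ Ioc a b) (hα : 0 < α)
    (hβ : 0 < β) (v : ℝ → ℝ) (hr : r ∈ Ioo a t) :
    ∫ s in Ioc a t, ‖iterKernel φ a b α β t v (s, r)‖ =
      Real.Gamma α * Real.Gamma β / Real.Gamma (α + β) *
        (dphi φ a b r * (φ t - φ r) ^ (α + β - 1) * ‖v r‖) := by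
  rw [← H.setIntegral_iterKernel_left ht hα hβ (fun r => ‖v r‖) hr]
  refine setIntegral_congr_fun measurableSet_Ioc fun s hs => ?_
  simp only [iterKernel, indicator, mem_ofPred_eq]
  split_ifs with h
  · have h1 := (H.pos s ⟨hs.1.le, hs.2.trans ht.2⟩).le
    have h2 := (H.pos r ⟨hr.1.le, hr.2.le.trans ht.2⟩).le
    have h3 := Real.rpow_nonneg (H.sub_nonneg hs.1.le hs.2 ht.2) (α - 1)
    have h4 := Real.rpow_nonneg (H.sub_nonneg hr.1.le h (hs.2.trans ht.2)) (β - 1)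
    rw [norm_mul, norm_mul (dphi φ a b r), Real.norm_of_nonneg h2, Real.norm_of_nonneg]
    positivity
  · simp

theorem integrable_iterKernel {α β t : ℝ} (ht : t ∈ Ioc a b) (hα : 0 < α) (hβ : 0 < β)
    (h1 : 1 ≤ α + β) {v : ℝ → ℝ} (hv : IntegrableOn v (Ioc a b)) :
    Integrable (iterKernel φ a b α β t v)
      ((volume.restrict (Ioc a t)).prod (volume.restrict (Ioc a t))) := by
  have hsub : Ioc a t ⊆ Icc a b := fun s hs => ⟨hs.1.le, hs.2.trans ht.2⟩
  have ae_ne : ∀ᵐ r ∂(volume.restrict (Ioc a t)), r ∈ Ioo a t := by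
    rw [restrict_Ioo_eq_restrict_Ioc.symm]
    exact ae_restrict_mem measurableSet_Ioo
  rw [integrable_prod_iff']
  · refine ⟨?_, ?_⟩
    · filter_upwards [ae_ne] with r hr
      rw [iterKernel_left]
      refine (integrable_indicator_iff measurableSet_Ici).2 ?_
      rw [IntegrableOn, Measure.restrict_restrict measurableSet_Ici, inter_comm,
        Ioc_inter_Ici_eq ⟨hr.1, hr.2.le⟩]
      refine Integrable.mul_const ?_ _
      exact (integrableOn_Icc_iff_integrableOn_Ioc).2
        (H.integrableOn_kernel hr.1.le hr.2 ht.2 hα hβ)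
    · refine ((H.integrableOn_kernel_mul (Ioc_subset_Icc_self ht) h1 hv.norm).const_mul
        (Real.Gamma α * Real.Gamma β / Real.Gamma (α + β))).congr ?_
      filter_upwards [ae_ne] with r hr
      exact (H.setIntegral_norm_iterKernel_left ht hα hβ v hr).symm
  · have m1 := H.aemeasurable_phi hsub measurableSet_Ioc
    have m2 := H.aemeasurable_dphi hsub measurableSet_Ioc
    have m3 := (hv.mono_set (Ioc_subset_Ioc_right ht.2)).aestronglyMeasurable.aemeasurable
    have hm : MeasurableSet {p : ℝ × ℝ | p.2 ≤ p.1} :=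
      measurableSet_le measurable_snd measurable_fst
    refine AEStronglyMeasurable.indicator (AEMeasurable.aestronglyMeasurable ?_) hm
    exact (m2.comp_fst.mul (((m1.comp_fst.const_sub (φ t)).pow_const _).mul
      ((m1.comp_fst.sub m1.comp_snd).pow_const _))).mul (m2.comp_snd.mul m3.comp_snd)

/-- Integrability of the outer integrand in an iterated fractional integral. -/
theorem integrableOn_kernel_mul_rlInt {α β t : ℝ} (ht : t ∈ Ioc a b) (hα : 0 < α) (hβ : 0 < β)
    (h1 : 1 ≤ α + β) {v : ℝ → ℝ} (hv : IntegrableOn v (Ioc a b)) :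
    IntegrableOn (fun s => dphi φ a b s * (φ t - φ s) ^ (α - 1) * rlInt φ a b β v s)
      (Ioc a t) := by
  have h := ((H.integrable_iterKernel ht hα hβ h1 hv).integral_prod_left).const_mul
    (1 / Real.Gamma β)
  refine h.congr ?_
  filter_upwards [ae_restrict_mem measurableSet_Ioc] with s hs
  rw [setIntegral_iterKernel_right v hs, rlInt_of_pos hβ hs.1.le]
  ring

/-- Semigroup property of the fractional integrals. -/
theorem rlInt_rlInt {α β t : ℝ} (ht : t ∈ Ioc a b) (hα : 0 ≤ α) (hβ : 0 ≤ β)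
    (h1 : 1 ≤ α + β) {v : ℝ → ℝ} (hv : IntegrableOn v (Ioc a b)) :
    rlInt φ a b α (rlInt φ a b β v) t = rlInt φ a b (α + β) v t := by
  rcases hα.eq_or_lt with rfl | hα
  · rw [rlInt_zero, zero_add]
  rcases hβ.eq_or_lt with rfl | hβ
  · rw [rlInt_zero, add_zero]
  have ae_ne : ∀ᵐ r ∂(volume.restrict (Ioc a t)), r ∈ Ioo a t := by
    rw [restrict_Ioo_eq_restrict_Ioc.symm]
    exact ae_restrict_mem measurableSet_Ioo
  have hsw := integral_integral_swap (f := fun s r => iterKernel φ a b α β t v (s, r))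
    (H.integrable_iterKernel ht hα hβ h1 hv)
  have e1 : ∫ s in Ioc a t, ∫ r in Ioc a t, iterKernel φ a b α β t v (s, r) =
      Real.Gamma β *
        ∫ s in Ioc a t, dphi φ a b s * (φ t - φ s) ^ (α - 1) * rlInt φ a b β v s := by
    rw [← integral_const_mul]
    refine setIntegral_congr_fun measurableSet_Ioc fun s hs => ?_
    rw [setIntegral_iterKernel_right v hs, rlInt_of_pos hβ hs.1.le]
    have := (Real.Gamma_pos_of_pos hβ).ne'
    field_simp
  have e2 : ∫ r in Ioc a t, ∫ s in Ioc a t, iterKernel φ a b α β t v (s, r) =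
      Real.Gamma α * Real.Gamma β / Real.Gamma (α + β) *
        ∫ r in Ioc a t, dphi φ a b r * (φ t - φ r) ^ (α + β - 1) * v r := by
    rw [← integral_const_mul]
    refine integral_congr_ae ?_
    filter_upwards [ae_ne] with r hr
    exact H.setIntegral_iterKernel_left ht hα hβ v hr
  rw [e1, e2] at hsw
  have hα' := (Real.Gamma_pos_of_pos hα).ne'
  have hβ' := (Real.Gamma_pos_of_pos hβ).ne'
  rw [rlInt_of_pos hα ht.1.le, rlInt_of_pos (add_pos hα hβ) ht.1.le]
  have h3 := mul_left_cancel₀ hβ' (hsw.trans (by ring :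
    _ = Real.Gamma β * (Real.Gamma α / Real.Gamma (α + β) *
        ∫ r in Ioc a t, dphi φ a b r * (φ t - φ r) ^ (α + β - 1) * v r)))
  rw [h3]
  field_simp

theorem integrableOn_rlInt {β : ℝ} (hβ : 0 ≤ β) {v : ℝ → ℝ} (hv : IntegrableOn v (Ioc a b)) :
    IntegrableOn (rlInt φ a b β v) (Ioc a b) := by
  rcases hβ.eq_or_lt with rfl | hβ
  · rwa [rlInt_zero]
  apply H.integrableOn_of_dphi_mul
  have h := H.integrableOn_kernel_mul_rlInt ⟨H.lt, le_rfl⟩ one_pos hβ (by linarith) hv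
  simpa using h

end IsTimeChange

/-! ### Inversion of the classical `φ`-Hilfer derivative -/

namespace IsTimeChange

variable {φ : ℝ → ℝ} {a b : ℝ} (H : IsTimeChange φ a b)
include H

theorem hasDerivWithinAt_rlInt_one {g : ℝ → ℝ} {t : ℝ} (ht : t ∈ Ioc a b)
    (hc : ContinuousOn g (Ioc a b)) (hg : IntegrableOn g (Ioc a b)) :
    HasDerivWithinAt (rlInt φ a b 1 g) (dphi φ a b t * g t) (Icc a b) t := by
  have hcont : ContinuousOn (fun s => dphi φ a b s * g s) (Ioc a b) :=
    (H.cont_deriv.mono Ioc_subset_Icc_self).mul hc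
  have hint := H.integrableOn_dphi_mul hg
  have hF : rlInt φ a b 1 g = fun u => ∫ s in a..u, dphi φ a b s * g s := by
    funext u
    simp [rlInt, Real.Gamma_one]
  have hmem : Ioc a b ∈ 𝓝[Icc a b] t := by
    filter_upwards [self_mem_nhdsWithin, mem_nhdsWithin_of_mem_nhds (Ioi_mem_nhds ht.1)]
      with s h1 h2 using ⟨h2, h1.2⟩
  have : Fact (t ∈ Icc a b) := ⟨Ioc_subset_Icc_self ht⟩
  rw [hF]
  refine intervalIntegral.integral_hasDerivWithinAt_right (t := Icc a b)
    (f := fun s => dphi φ a b s * g s) ?_ ?_ ?_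
  · rw [intervalIntegrable_iff_integrableOn_Ioc_of_le ht.1.le]
    exact hint.mono_set (Ioc_subset_Ioc_right ht.2)
  · exact ⟨Ioc a b, hmem, hint.aestronglyMeasurable⟩
  · exact (hcont t ht).mono_of_mem_nhdsWithin hmem

theorem continuousOn_rlInt_one {g : ℝ → ℝ}
    (hc : ContinuousOn g (Ioc a b)) (hg : IntegrableOn g (Ioc a b)) :
    ContinuousOn (rlInt φ a b 1 g) (Ioc a b) := fun _ ht =>
  (H.hasDerivWithinAt_rlInt_one ht hc hg).continuousWithinAt.mono Ioc_subset_Icc_self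

theorem eqOn_of_rlInt_one_eqOn {g k : ℝ → ℝ}
    (hgc : ContinuousOn g (Ioc a b)) (hg : IntegrableOn g (Ioc a b))
    (hkc : ContinuousOn k (Ioc a b)) (hk : IntegrableOn k (Ioc a b))
    (h : EqOn (rlInt φ a b 1 g) (rlInt φ a b 1 k) (Ioc a b)) : EqOn g k (Ioc a b) := by
  intro t ht
  have h1 := H.phiD_eq ht (H.hasDerivWithinAt_rlInt_one ht hgc hg)
  have h2 := H.phiD_eq ht
    (hasDerivWithinAt_congr ht h (H.hasDerivWithinAt_rlInt_one ht hkc hk))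
  exact h1.symm.trans h2

theorem eqOn_of_rlInt_two_eqOn {g k : ℝ → ℝ}
    (hgc : ContinuousOn g (Ioc a b)) (hg : IntegrableOn g (Ioc a b))
    (hkc : ContinuousOn k (Ioc a b)) (hk : IntegrableOn k (Ioc a b))
    (h : EqOn (rlInt φ a b 2 g) (rlInt φ a b 2 k) (Ioc a b)) : EqOn g k (Ioc a b) := by
  refine H.eqOn_of_rlInt_one_eqOn hgc hg hkc hk
    (H.eqOn_of_rlInt_one_eqOn (H.continuousOn_rlInt_one hgc hg)
      (H.integrableOn_rlInt zero_le_one hg) (H.continuousOn_rlInt_one hkc hk)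
      (H.integrableOn_rlInt zero_le_one hk) fun t ht => ?_)
  rw [H.rlInt_rlInt ht zero_le_one zero_le_one (by norm_num) hg,
    H.rlInt_rlInt ht zero_le_one zero_le_one (by norm_num) hk, one_add_one_eq_two]
  exact h ht

omit H in
theorem exists_const_of_hasDerivWithinAt_zero {F : ℝ → ℝ}
    (hF : ∀ t ∈ Ioc a b, HasDerivWithinAt F 0 (Icc a b) t) : ∃ c, ∀ t ∈ Ioc a b, F t = c := by
  refine ⟨F b, fun t ht => ?_⟩
  have h := (convex_Ioc a b).norm_image_sub_le_of_norm_hasDerivWithin_le (C := 0)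
    (fun s hs => (hF s hs).mono Ioc_subset_Icc_self) (fun s _ => by simp)
    (⟨ht.1.trans_le ht.2, le_rfl⟩ : b ∈ Ioc a b) ht
  rw [zero_mul, norm_le_zero_iff, _root_.sub_eq_zero] at h
  exact h

/-- A function whose second `φ`-derivative is continuous on `(a, b]` and integrable is recovered
from it by integrating twice, up to an affine function of `φ`. -/
theorem exists_eq_affine_add_rlInt_two {G : ℝ → ℝ}
    (h1 : ∀ t ∈ Ioc a b, DifferentiableWithinAt ℝ G (Icc a b) t)
    (h2 : ∀ t ∈ Ioc a b, DifferentiableWithinAt ℝ (phiD φ a b G) (Icc a b) t)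
    (hc : ContinuousOn (phiD φ a b (phiD φ a b G)) (Ioc a b))
    (hi : IntegrableOn (phiD φ a b (phiD φ a b G)) (Ioc a b)) :
    ∃ p q : ℝ, ∀ t ∈ Ioc a b,
      G t = p + q * (φ t - φ a) + rlInt φ a b 2 (phiD φ a b (phiD φ a b G)) t := by
  set v := phiD φ a b (phiD φ a b G) with hv
  have hd : ∀ (F : ℝ → ℝ) (t : ℝ), t ∈ Ioc a b → DifferentiableWithinAt ℝ F (Icc a b) t →
      HasDerivWithinAt F (dphi φ a b t * phiD φ a b F t) (Icc a b) t := by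
    intro F t ht hF
    refine hF.hasDerivWithinAt.congr_deriv ?_
    have := (H.pos t (Ioc_subset_Icc_self ht)).ne'
    rw [phiD]
    field_simp
  obtain ⟨q, hq⟩ := exists_const_of_hasDerivWithinAt_zero
    (F := fun t => phiD φ a b G t - rlInt φ a b 1 v t) (fun t ht =>
      ((hd _ t ht (h2 t ht)).sub (H.hasDerivWithinAt_rlInt_one ht hc hi)).congr_deriv
        (by rw [hv]; ring))
  obtain ⟨p, hp⟩ := exists_const_of_hasDerivWithinAt_zero
    (F := fun t => G t - rlInt φ a b 1 (rlInt φ a b 1 v) t - q * (φ t - φ a)) (fun t ht =>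
      (((hd _ t ht (h1 t ht)).sub (H.hasDerivWithinAt_rlInt_one ht
        (H.continuousOn_rlInt_one hc hi) (H.integrableOn_rlInt zero_le_one hi))).sub
        (((H.deriv t (Ioc_subset_Icc_self ht)).sub_const (φ a)).const_mul q)).congr_deriv
        (by rw [← hq t ht]; ring))
  refine ⟨p, q, fun t ht => ?_⟩
  have h := hp t ht
  rw [H.rlInt_rlInt ht zero_le_one zero_le_one (by norm_num) hi, one_add_one_eq_two] at h
  linarith

theorem rpow_neg_mul_rpow {γ t : ℝ} (ht : t ∈ Ioc a b) :
    (φ t - φ a) ^ (-γ) * (φ t - φ a) ^ γ = 1 := by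
  rw [← Real.rpow_add (H.sub_pos_of_mem ht), neg_add_cancel, Real.rpow_zero]

theorem continuousOn_rpow (e : ℝ) : ContinuousOn (fun t => (φ t - φ a) ^ e) (Ioc a b) :=
  (H.cont_sub.mono Ioc_subset_Icc_self).rpow_const fun _ ht =>
    Or.inl (H.sub_pos_of_mem ht).ne'

theorem continuousOn_fracPow (e : ℝ) : ContinuousOn (fracPow φ a e) (Ioc a b) :=
  (H.continuousOn_rpow e).div_const _

theorem continuousOn_of_memC {γ : ℝ} {h : ℝ → ℝ} (hm : MemC φ a b γ h) :
    ContinuousOn h (Ioc a b) := by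
  obtain ⟨F, hF, hFh⟩ := hm
  refine ((H.continuousOn_rpow (-γ)).mul (hF.mono Ioc_subset_Icc_self)).congr fun t ht => ?_
  rw [Pi.mul_apply, hFh t ht, ← mul_assoc, H.rpow_neg_mul_rpow ht, one_mul]

/-- Functions bounded by a multiple of an integrable power of `φ - φ(a)` are integrable. -/
theorem integrableOn_of_abs_le {e M : ℝ} (he : -1 < e) {g : ℝ → ℝ}
    (hm : AEStronglyMeasurable g (volume.restrict (Ioc a b)))
    (hg : ∀ t ∈ Ioc a b, |g t| ≤ M * (φ t - φ a) ^ e) : IntegrableOn g (Ioc a b) := by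
  refine Integrable.mono' ((H.integrableOn_rpow he).const_mul M) hm ?_
  exact (ae_restrict_iff' measurableSet_Ioc).2 (Eventually.of_forall hg)

theorem integrableOn_of_memC {γ : ℝ} (hγ : γ < 1) {h : ℝ → ℝ} (hm : MemC φ a b γ h) :
    IntegrableOn h (Ioc a b) := by
  have hc := H.continuousOn_of_memC hm
  obtain ⟨F, hF, hFh⟩ := hm
  obtain ⟨M, hM⟩ := isCompact_Icc.exists_bound_of_continuousOn hF
  refine H.integrableOn_of_abs_le (e := -γ) (M := M) (by linarith)
    (hc.aestronglyMeasurable measurableSet_Ioc) fun t ht => ?_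
  have h1 := hM t (Ioc_subset_Icc_self ht)
  have h2 : h t = (φ t - φ a) ^ (-γ) * F t := by
    rw [hFh t ht, ← mul_assoc, H.rpow_neg_mul_rpow ht, one_mul]
  have h3 : 0 < (φ t - φ a) ^ (-γ) := Real.rpow_pos_of_pos (H.sub_pos_of_mem ht) _
  rw [h2, abs_mul, abs_of_pos h3, mul_comm]
  exact mul_le_mul_of_nonneg_right h1 h3.le

theorem rlInt_add_fracPow {t α e₀ e₁ p q : ℝ} (ht : t ∈ Ioc a b) (hα : 1 ≤ α) (h₀ : -1 < e₀)
    (h₁ : -1 < e₁) {w : ℝ → ℝ} (hw : IntegrableOn w (Ioc a b)) :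
    rlInt φ a b α (fun s => p * fracPow φ a e₀ s + q * fracPow φ a e₁ s + w s) t =
      p * fracPow φ a (e₀ + α) t + q * fracPow φ a (e₁ + α) t + rlInt φ a b α w t := by
  have hi0 := (H.integrableOn_fracPow h₀).const_mul p
  have hi1 := (H.integrableOn_fracPow h₁).const_mul q
  have ht' := Ioc_subset_Icc_self ht
  rw [H.rlInt_add (g := fun s => p * fracPow φ a e₀ s + q * fracPow φ a e₁ s) ht' hα
    (hi0.add hi1) hw, H.rlInt_add ht' hα hi0 hi1, rlInt_const_mul, rlInt_const_mul,
    H.rlInt_fracPow ht (by linarith) h₀, H.rlInt_fracPow ht (by linarith) h₁]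

/-- Inversion of the inner fractional integral of a `φ`-Hilfer derivative. -/
theorem eq_fracPow_add_rlInt {γ p q : ℝ} (hγ₀ : 0 ≤ γ) (hγ₁ : γ < 1) {h v : ℝ → ℝ}
    (hm : MemC φ a b γ h) (hv : IntegrableOn v (Ioc a b))
    (hG : ∀ t ∈ Ioc a b, rlInt φ a b γ h t = p + q * (φ t - φ a) + rlInt φ a b 2 v t) :
    ∀ t ∈ Ioc a b, h t = p * fracPow φ a (-γ) t + q * fracPow φ a (1 - γ) t +
      rlInt φ a b (2 - γ) v t := by
  have hG' : EqOn (rlInt φ a b γ h)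
      (fun t => (p * fracPow φ a 0 t + q * fracPow φ a 1 t) + rlInt φ a b 2 v t) (Ioc a b) := by
    intro t ht
    have : Real.Gamma (1 + 1) = 1 := by rw [one_add_one_eq_two]; exact Real.Gamma_two
    simp only [fracPow, hG t ht, Real.rpow_zero, Real.rpow_one, zero_add, Real.Gamma_one, this]
    ring
  have hj2 := H.integrableOn_rlInt (by linarith : 0 ≤ 2 - γ) hv
  refine H.eqOn_of_rlInt_two_eqOn (H.continuousOn_of_memC hm) (H.integrableOn_of_memC hγ₁ hm)
    ?_ ((((H.integrableOn_fracPow (by linarith)).const_mul p).add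
      ((H.integrableOn_fracPow (by linarith)).const_mul q)).add hj2) fun t ht => ?_
  · exact (((H.continuousOn_fracPow _).const_mul p).add
      ((H.continuousOn_fracPow _).const_mul q)).add
      ((H.continuousOn_rlInt (by linarith) hv).mono Ioc_subset_Icc_self)
  · have ht' := Ioc_subset_Icc_self ht
    have e1 := H.rlInt_rlInt ht (by linarith : 0 ≤ 2 - γ) hγ₀ (by linarith)
      (H.integrableOn_of_memC hγ₁ hm)
    rw [sub_add_cancel] at e1
    rw [← e1, rlInt_congr ht hG', H.rlInt_add_fracPow ht (by linarith) (by norm_num)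
      (by norm_num) (H.integrableOn_rlInt zero_le_two hv), H.rlInt_add_fracPow ht one_le_two
      (by linarith) (by linarith) hj2,
      H.rlInt_rlInt ht (by linarith) (by linarith) (by linarith) hv,
      H.rlInt_rlInt ht (by linarith) (by linarith) (by linarith) hv]
    ring_nf

/-- A pointwise limit on `(a, b]` of affine functions of `φ` is affine in `φ`. -/
theorem exists_affine_of_tendsto {p q : ℕ → ℝ} {d : ℝ → ℝ}
    (h : ∀ t ∈ Ioc a b, Tendsto (fun n => p n + q n * (φ t - φ a)) atTop (𝓝 (d t))) :
    ∃ p' q' : ℝ, ∀ t ∈ Ioc a b, d t = p' + q' * (φ t - φ a) := by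
  obtain ⟨c, hc⟩ := exists_between H.lt
  have hcb : c ∈ Ioc a b := ⟨hc.1, hc.2.le⟩
  have hbb : b ∈ Ioc a b := ⟨H.lt, le_rfl⟩
  have hpos := H.sub_pos hc.1.le hc.2 le_rfl
  have hq : Tendsto q atTop (𝓝 ((d b - d c) / (φ b - φ c))) := by
    refine (((h b hbb).sub (h c hcb)).div_const (φ b - φ c)).congr fun n => ?_
    field_simp
    ring
  have hp := (h b hbb).sub (hq.mul_const (φ b - φ a))
  refine ⟨_, _, fun t ht => tendsto_nhds_unique (h t ht)
    (((hp.congr fun n => ?_)).add (hq.mul_const (φ t - φ a)))⟩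
  ring

end IsTimeChange

/-- A function with a classical `φ`-Hilfer derivative is the fractional integral of order `μ` of
that derivative, up to an element of the kernel of the derivative. -/
theorem HasClassicalHilfer.integrableOn_and_repr {φ : ℝ → ℝ} {a b μ ν : ℝ}
    (H : IsTimeChange φ a b)
    (hμ₁ : 1 < μ) (hμ₂ : μ < 2) (hν₀ : 0 ≤ ν) (hν₁ : ν ≤ 1) {h : ℝ → ℝ}
    (hh : HasClassicalHilfer φ a b μ ν h) :
    IntegrableOn (hilferFormula φ a b μ ν h) (Ioc a b) ∧
    ∃ p q : ℝ, ∀ t ∈ Ioc a b,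
      h t = p * fracPow φ a (-(2 - xi μ ν)) t + q * fracPow φ a (1 - (2 - xi μ ν)) t +
        rlInt φ a b μ (hilferFormula φ a b μ ν h) t := by
  have hγ : (1 - ν) * (2 - μ) = 2 - xi μ ν := by unfold xi; ring
  have hγ₀ : 0 ≤ 2 - xi μ ν := by
    rw [← hγ]; exact mul_nonneg (by linarith) (by linarith)
  have hβ : 0 ≤ ν * (2 - μ) := mul_nonneg hν₀ (by linarith)
  have hγ₁ : 2 - xi μ ν < 1 := by unfold xi; linarith
  obtain ⟨p, q, hpq⟩ := H.exists_eq_affine_add_rlInt_two hh.diff₁ hh.diff₂ hh.cont hh.integrable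
  have hr := H.eq_fracPow_add_rlInt hγ₀ hγ₁ hh.mem hh.integrable
    (fun t ht => by rw [← hpq t ht, hγ])
  refine ⟨H.integrableOn_rlInt hβ hh.integrable, p, q, fun t ht => ?_⟩
  rw [hr t ht, hilferFormula, H.rlInt_rlInt ht (by linarith) hβ (by linarith) hh.integrable,
    show 2 - (2 - xi μ ν) = μ + ν * (2 - μ) by unfold xi; ring]

/-! ### Functions with a `φ`-Hilfer derivative as fractional integrals -/

theorem MemC.congr {φ : ℝ → ℝ} {a b γ : ℝ} {h k : ℝ → ℝ} (hm : MemC φ a b γ h)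
    (hk : EqOn k h (Ioc a b)) : MemC φ a b γ k := by
  obtain ⟨F, hF, hFh⟩ := hm
  exact ⟨F, hF, fun t ht => by rw [hFh t ht, hk ht]⟩

namespace IsTimeChange

variable {φ : ℝ → ℝ} {a b : ℝ} (H : IsTimeChange φ a b)
include H

theorem abs_sub_le_of_weighted {γ ε x y t : ℝ} (ht : t ∈ Ioc a b)
    (h : |(φ t - φ a) ^ γ * x - (φ t - φ a) ^ γ * y| ≤ ε) :
    |x - y| ≤ ε * (φ t - φ a) ^ (-γ) := by
  have h3 : 0 < (φ t - φ a) ^ γ := Real.rpow_pos_of_pos (H.sub_pos_of_mem ht) _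
  rw [← mul_sub, abs_mul, abs_of_pos h3] at h
  rw [Real.rpow_neg (H.sub_pos_of_mem ht).le, ← div_eq_mul_inv, le_div_iff₀ h3, mul_comm]
  exact h

theorem rpow_mul_fracPow {γ e t : ℝ} (ht : t ∈ Ioc a b) :
    (φ t - φ a) ^ γ * fracPow φ a e t = (φ t - φ a) ^ (γ + e) / Real.Gamma (e + 1) := by
  rw [fracPow, Real.rpow_add (H.sub_pos_of_mem ht), mul_div_assoc]

/-- Fractional integration is bounded on the weighted space. -/
theorem abs_rlInt_sub_le {γ μ M t : ℝ} (hγ : γ < 1) (hμ : 1 ≤ μ) {g k : ℝ → ℝ}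
    (hg : IntegrableOn g (Ioc a b)) (hk : IntegrableOn k (Ioc a b))
    (hM : ∀ s ∈ Ioc a b, |g s - k s| ≤ M * (φ s - φ a) ^ (-γ)) (ht : t ∈ Ioc a b) :
    |rlInt φ a b μ g t - rlInt φ a b μ k t| ≤
      M * (Real.Gamma (1 - γ) * fracPow φ a (μ - γ) t) := by
  have hΓ : 0 < Real.Gamma (1 - γ) := Real.Gamma_pos_of_pos (by linarith)
  have ht' := Ioc_subset_Icc_self ht
  have h := H.abs_rlInt_le (α := μ) (g := fun s => g s - k s)
    (G := fun s => M * Real.Gamma (1 - γ) * fracPow φ a (-γ) s) ht' (by linarith)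
    (H.integrableOn_kernel_mul ht' hμ
      ((H.integrableOn_fracPow (by linarith)).const_mul _)) fun s hs => by
        refine (hM s ⟨hs.1, hs.2.trans ht.2⟩).trans_eq ?_
        rw [fracPow, neg_add_eq_sub]
        field_simp
  rw [H.rlInt_sub ht' hμ hg hk, rlInt_const_mul, H.rlInt_fracPow ht (by linarith) (by linarith),
    neg_add_eq_sub, mul_assoc] at h
  exact h

theorem tendsto_at {γ t : ℝ} {hn : ℕ → ℝ → ℝ} {h : ℝ → ℝ}
    (hc : TendstoC φ a b γ hn h) (ht : t ∈ Ioc a b) :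
    Tendsto (fun n => hn n t) atTop (𝓝 (h t)) := by
  have h1 := (TendstoUniformlyOn.tendsto_at hc ht).const_mul ((φ t - φ a) ^ (-γ))
  simpa only [← mul_assoc, H.rpow_neg_mul_rpow ht, one_mul] using h1

theorem eventually_abs_sub_le {γ ε : ℝ} (hε : 0 < ε) {hn : ℕ → ℝ → ℝ} {h : ℝ → ℝ}
    (hc : TendstoC φ a b γ hn h) :
    ∀ᶠ n in atTop, ∀ t ∈ Ioc a b, |hn n t - h t| ≤ ε * (φ t - φ a) ^ (-γ) := by
  filter_upwards [Metric.tendstoUniformlyOn_iff.1 hc ε hε] with n hn t ht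
  refine H.abs_sub_le_of_weighted ht ?_
  rw [abs_sub_comm]
  exact (hn t ht).le

end IsTimeChange

/-- A function with a `φ`-Hilfer derivative `g` is the fractional integral of order `μ` of `g`,
up to an element of the kernel of the derivative. The derivative `g` need not lie in the weighted
space, but it is integrable. -/
theorem IsHilferDeriv.integrableOn_and_repr {φ : ℝ → ℝ} {a b μ ν : ℝ} (H : IsTimeChange φ a b)
    (hμ₁ : 1 < μ) (hμ₂ : μ < 2) (hν₀ : 0 ≤ ν) (hν₁ : ν ≤ 1) {h g : ℝ → ℝ}
    (hg : IsHilferDeriv φ a b μ ν h g) :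
    IntegrableOn g (Ioc a b) ∧ ∃ p q : ℝ, ∀ t ∈ Ioc a b,
      h t = p * fracPow φ a (-(2 - xi μ ν)) t + q * fracPow φ a (1 - (2 - xi μ ν)) t +
        rlInt φ a b μ g t := by
  obtain ⟨-, hn, hcl, hh, hD⟩ := hg
  set γ := 2 - xi μ ν with hγ
  have hγ₁ : γ < 1 := by rw [hγ]; unfold xi; nlinarith
  have hrep := fun n => (hcl n).integrableOn_and_repr H hμ₁ hμ₂ hν₀ hν₁
  rw [← hγ] at hrep
  have hmeas : AEStronglyMeasurable g (volume.restrict (Ioc a b)) :=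
    aestronglyMeasurable_of_tendsto_ae atTop (fun n => (hrep n).1.aestronglyMeasurable)
      ((ae_restrict_iff' measurableSet_Ioc).2 (Eventually.of_forall fun t ht =>
        H.tendsto_at hD ht))
  have hint : IntegrableOn g (Ioc a b) := by
    obtain ⟨n, hle⟩ := (H.eventually_abs_sub_le one_pos hD).exists
    have h1 : IntegrableOn (fun t => hilferFormula φ a b μ ν (hn n) t - g t) (Ioc a b) :=
      H.integrableOn_of_abs_le (by linarith)
        ((hrep n).1.aestronglyMeasurable.sub hmeas) hle
    refine ((hrep n).1.sub h1).congr (Eventually.of_forall fun t => ?_)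
    simp
  refine ⟨hint, ?_⟩
  choose hi p q hpq using hrep
  have hΓ₁ : 0 < Real.Gamma (1 - γ) := Real.Gamma_pos_of_pos (by linarith)
  have hΓ₂ : 0 < Real.Gamma (1 - γ + 1) := Real.Gamma_pos_of_pos (by linarith)
  -- After multiplication by the weight, the remainders `hn n - I^μ (D (hn n))` are affine in `φ`.
  have hlim : ∀ t ∈ Ioc a b, Tendsto (fun n => p n / Real.Gamma (1 - γ) +
      q n / Real.Gamma (1 - γ + 1) * (φ t - φ a)) atTop
      (𝓝 ((φ t - φ a) ^ γ * (h t - rlInt φ a b μ g t))) := by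
    intro t ht
    have hI : Tendsto (fun n => rlInt φ a b μ (hilferFormula φ a b μ ν (hn n)) t) atTop
        (𝓝 (rlInt φ a b μ g t)) := by
      rw [Metric.tendsto_nhds]
      intro ε hε
      set B := Real.Gamma (1 - γ) * fracPow φ a (μ - γ) t with hB
      have hB0 : 0 < B := mul_pos hΓ₁ (div_pos (Real.rpow_pos_of_pos (H.sub_pos_of_mem ht) _)
        (Real.Gamma_pos_of_pos (by linarith)))
      filter_upwards [H.eventually_abs_sub_le (half_pos (div_pos hε hB0)) hD] with n hle
      refine (H.abs_rlInt_sub_le hγ₁ hμ₁.le (hi n) hint hle ht).trans_lt ?_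
      rw [← hB]
      field_simp
      linarith
    refine (((H.tendsto_at hh ht).sub hI).const_mul ((φ t - φ a) ^ γ)).congr fun n => ?_
    rw [hpq n t ht, add_sub_cancel_right, mul_add, mul_left_comm, mul_left_comm _ (q n),
      H.rpow_mul_fracPow ht, H.rpow_mul_fracPow ht, add_neg_cancel, add_sub_cancel,
      Real.rpow_zero, Real.rpow_one, neg_add_eq_sub]
    ring
  obtain ⟨p', q', h'⟩ := H.exists_affine_of_tendsto hlim
  refine ⟨p' * Real.Gamma (1 - γ), q' * Real.Gamma (1 - γ + 1), fun t ht => ?_⟩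
  have h0 := H.sub_pos_of_mem ht
  have h1 : h t - rlInt φ a b μ g t =
      (φ t - φ a) ^ (-γ) * ((φ t - φ a) ^ γ * (h t - rlInt φ a b μ g t)) := by
    rw [← mul_assoc, H.rpow_neg_mul_rpow ht, one_mul]
  rw [h' t ht] at h1
  rw [eq_add_of_sub_eq h1, fracPow, fracPow, neg_add_eq_sub, sub_eq_neg_add 1 γ,
    Real.rpow_add h0, Real.rpow_one, ← sub_eq_neg_add 1 γ]
  field_simp

/-! ### Fractional integrals as functions with a `φ`-Hilfer derivative -/

namespace IsTimeChange

variable {φ : ℝ → ℝ} {a b : ℝ} (H : IsTimeChange φ a b)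
include H

/-- Weierstrass approximation by polynomials in `φ - φ(a)`. -/
theorem exists_polynomial_near {F : ℝ → ℝ} (hF : ContinuousOn F (Icc a b)) {ε : ℝ} (hε : 0 < ε) :
    ∃ P : Polynomial ℝ, ∀ t ∈ Icc a b, |P.eval (φ t - φ a) - F t| < ε := by
  let u : C(Icc a b, ℝ) := ⟨(Icc a b).domRestrict fun t => φ t - φ a, H.cont_sub.domRestrict⟩
  have hsep : (Algebra.adjoin ℝ {u}).SeparatesPoints := by
    intro x y hxy
    refine ⟨u, ⟨u, Algebra.subset_adjoin rfl, rfl⟩, fun h => hxy ?_⟩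
    have h' : φ x - φ a = φ y - φ a := h
    exact Subtype.ext (H.mono.injOn x.2 y.2 (by linarith))
  obtain ⟨⟨g, hg⟩, hgF⟩ := ContinuousMap.exists_mem_subalgebra_near_continuous_of_separatesPoints
    (Algebra.adjoin ℝ {u}) hsep ((Icc a b).domRestrict F) hF.domRestrict ε hε
  rw [Algebra.adjoin_singleton_eq_range_aeval] at hg
  obtain ⟨P, rfl⟩ := hg
  refine ⟨P, fun t ht => ?_⟩
  have h := hgF ⟨t, ht⟩
  have e : (Polynomial.aeval u P : C(Icc a b, ℝ)) ⟨t, ht⟩ = P.eval (φ t - φ a) := by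
    have h2 := Polynomial.aeval_algHom_apply
      (ContinuousMap.evalAlgHom ℝ ℝ (⟨t, ht⟩ : Icc a b)) u P
    rw [← Polynomial.coe_aeval_eq_eval]
    exact h2.symm
  rw [← e]
  exact h

theorem memC_fracPow_add_rlInt {γ μ : ℝ} (hγ : 0 ≤ γ) (hμ : 1 < μ) (p q : ℝ)
    {g : ℝ → ℝ} (hg : IntegrableOn g (Ioc a b)) :
    MemC φ a b γ (fun t => p * fracPow φ a (-γ) t + q * fracPow φ a (1 - γ) t +
      rlInt φ a b μ g t) := by
  refine ⟨fun t => p / Real.Gamma (-γ + 1) + q / Real.Gamma (1 - γ + 1) * (φ t - φ a) +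
    (φ t - φ a) ^ γ * rlInt φ a b μ g t, ?_, fun t ht => ?_⟩
  · exact (continuousOn_const.add (continuousOn_const.mul H.cont_sub)).add
      ((H.cont_sub.rpow_const fun _ _ => Or.inr hγ).mul (H.continuousOn_rlInt hμ hg))
  · rw [mul_add, mul_add, mul_left_comm, mul_left_comm _ q,
      H.rpow_mul_fracPow ht, H.rpow_mul_fracPow ht, add_neg_cancel, add_sub_cancel,
      Real.rpow_zero, Real.rpow_one]
    ring

/-- The `φ`-Hilfer derivative of a finite sum of powers of `φ - φ(a)`, computed term by term. -/
theorem hasClassicalHilfer_sum {μ ν : ℝ} (hμ₁ : 1 < μ) (hμ₂ : μ < 2) (hν₀ : 0 ≤ ν) (hν₁ : ν ≤ 1)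
    (p q : ℝ) (N : ℕ) (A : Fin N → ℝ) {h : ℝ → ℝ}
    (hh : ∀ t ∈ Ioc a b, h t = p * fracPow φ a (-(2 - xi μ ν)) t +
      q * fracPow φ a (1 - (2 - xi μ ν)) t +
      rlInt φ a b μ (fun s => ∑ k, A k * fracPow φ a ((k : ℕ) - (2 - xi μ ν)) s) t) :
    HasClassicalHilfer φ a b μ ν h ∧ ∀ t ∈ Ioc a b,
      hilferFormula φ a b μ ν h t = ∑ k, A k * fracPow φ a ((k : ℕ) - (2 - xi μ ν)) t := by
  have hγ' : (1 - ν) * (2 - μ) = 2 - xi μ ν := by unfold xi; ring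
  have hβ : ν * (2 - μ) = 2 - μ - (2 - xi μ ν) := by unfold xi; ring
  have hβ₀ : 0 ≤ 2 - μ - (2 - xi μ ν) := hβ ▸ mul_nonneg hν₀ (by linarith)
  have hγ₀ : 0 ≤ 2 - xi μ ν := hγ' ▸ mul_nonneg (by linarith) (by linarith)
  set γ := 2 - xi μ ν with hγ
  have hk : ∀ k : Fin N, (0 : ℝ) ≤ ((k : ℕ) : ℝ) := fun k => Nat.cast_nonneg _
  have hgi : IntegrableOn (fun s => ∑ k, A k * fracPow φ a ((k : ℕ) - γ) s) (Ioc a b) :=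
    integrable_finsetSum _ fun k _ =>
      (H.integrableOn_fracPow (by linarith [hk k])).const_mul _
  -- The coefficients and exponents of `h`, with the two kernel terms first.
  let A' : Fin 2 ⊕ Fin N → ℝ := Sum.elim ![p, q] A
  let e' : Fin 2 ⊕ Fin N → ℝ := Sum.elim ![-γ, 1 - γ] (fun k => ((k : ℕ) : ℝ) - γ + μ)
  have he' : ∀ i ∈ (Finset.univ : Finset (Fin 2 ⊕ Fin N)), -1 < e' i := by
    rintro (i | k) -
    · fin_cases i
      · show -1 < -γ
        linarith
      · show -1 < 1 - γ
        linarith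
    · show -1 < ((k : ℕ) : ℝ) - γ + μ
      linarith [hk k]
  have h1 : EqOn h (fun t => ∑ i, A' i * fracPow φ a (e' i) t) (Ioc a b) := by
    intro t ht
    rw [hh t ht, H.rlInt_sum_fracPow _ _ _ ht (by linarith) fun k _ => by linarith [hk k]]
    simp [A', e', Fintype.sum_sum_type, Fin.sum_univ_two]
  have h2 : EqOn (rlInt φ a b γ h) (fun t => ∑ i, A' i * fracPow φ a (e' i + γ) t)
      (Ioc a b) := fun t ht => by
    rw [rlInt_congr ht h1, H.rlInt_sum_fracPow _ _ _ ht hγ₀ he']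
  have h3 := fun t (ht : t ∈ Ioc a b) => hasDerivWithinAt_congr ht h2
    (H.hasDerivWithinAt_sum_fracPow Finset.univ A' (fun i => e' i + γ) ht)
  have h4 : EqOn (phiD φ a b (rlInt φ a b γ h))
      (fun t => ∑ i, A' i * fracPow φ a (e' i + γ - 1) t) (Ioc a b) :=
    fun t ht => H.phiD_eq ht (h3 t ht)
  have h5 := fun t (ht : t ∈ Ioc a b) => hasDerivWithinAt_congr ht h4
    (H.hasDerivWithinAt_sum_fracPow Finset.univ A' (fun i => e' i + γ - 1) ht)
  have h6 : EqOn (phiD φ a b (phiD φ a b (rlInt φ a b γ h)))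
      (fun t => ∑ k, A k * fracPow φ a ((k : ℕ) + μ - 2) t) (Ioc a b) := by
    intro t ht
    rw [H.phiD_eq ht (h5 t ht), Fintype.sum_sum_type, Fin.sum_univ_two]
    -- The normalised powers with exponents `-2` and `-1` vanish, as `1 / Γ` does at `-1` and `0`.
    have e0 : fracPow φ a (e' (Sum.inl 0) + γ - 1 - 1) t = 0 := by
      have : e' (Sum.inl 0) + γ - 1 - 1 + 1 = -((1 : ℕ) : ℝ) := by simp [e']
      rw [fracPow, this, Real.Gamma_neg_nat_eq_zero, div_zero]
    have e1 : fracPow φ a (e' (Sum.inl 1) + γ - 1 - 1) t = 0 := by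
      have : e' (Sum.inl 1) + γ - 1 - 1 + 1 = 0 := by simp [e']
      rw [fracPow, this, Real.Gamma_zero, div_zero]
    rw [e0, e1, mul_zero, mul_zero, zero_add, zero_add]
    refine Finset.sum_congr rfl fun k _ => ?_
    simp only [A', e', Sum.elim_inr]
    ring_nf
  refine ⟨⟨(H.memC_fracPow_add_rlInt hγ₀ hμ₁ p q hgi).congr hh, ?_, ?_, ?_, ?_⟩, fun t ht => ?_⟩
  · rw [hγ']
    exact fun t ht => (h3 t ht).differentiableWithinAt
  · rw [hγ']
    exact fun t ht => (h5 t ht).differentiableWithinAt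
  · rw [hγ']
    exact (continuousOn_finsetSum _ fun k _ =>
      (H.continuousOn_fracPow _).const_mul (A k)).congr h6
  · rw [hγ']
    refine IntegrableOn.congr_fun ?_ h6.symm measurableSet_Ioc
    exact integrable_finsetSum _ fun k _ =>
      (H.integrableOn_fracPow (by linarith [hk k])).const_mul _
  · rw [hilferFormula, hγ', hβ, rlInt_congr ht h6,
      H.rlInt_sum_fracPow _ _ _ ht hβ₀ fun k _ => by linarith [hk k]]
    refine Finset.sum_congr rfl fun k _ => ?_
    ring_nf

/-- Every `g` in the weighted space is the `φ`-Hilfer derivative of its fractional integral of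
order `μ`, with an arbitrary element of the kernel of the derivative added. -/
theorem isHilferDeriv_fracPow_add_rlInt {μ ν : ℝ} (hμ₁ : 1 < μ) (hμ₂ : μ < 2) (hν₀ : 0 ≤ ν)
    (hν₁ : ν ≤ 1) (p q : ℝ) {g : ℝ → ℝ} (hg : MemC φ a b (2 - xi μ ν) g) :
    IsHilferDeriv φ a b μ ν (fun t => p * fracPow φ a (-(2 - xi μ ν)) t +
      q * fracPow φ a (1 - (2 - xi μ ν)) t + rlInt φ a b μ g t) g := by
  have hγ₀ : 0 ≤ 2 - xi μ ν := by unfold xi; nlinarith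
  have hγ₁ : 2 - xi μ ν < 1 := by unfold xi; nlinarith
  set γ := 2 - xi μ ν with hγ
  have hgi := H.integrableOn_of_memC hγ₁ hg
  refine ⟨H.memC_fracPow_add_rlInt hγ₀ hμ₁ p q hgi, ?_⟩
  rw [← hγ]
  obtain ⟨F, hF, hFg⟩ := hg
  choose P hP using fun n : ℕ => H.exists_polynomial_near hF (ε := 1 / (n + 1)) (by positivity)
  -- `gn n` is `(φ - φ(a)) ^ (-γ)` times the polynomial `P n`, as a sum of normalised powers.
  let A : (n : ℕ) → Fin ((P n).natDegree + 1) → ℝ := fun n k =>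
    (P n).coeff k * Real.Gamma ((k : ℕ) - γ + 1)
  let gn : ℕ → ℝ → ℝ := fun n s => ∑ k, A n k * fracPow φ a ((k : ℕ) - γ) s
  have hgni : ∀ n, IntegrableOn (gn n) (Ioc a b) := fun n => integrable_finsetSum _ fun k _ =>
      (H.integrableOn_fracPow (by
        have : (0 : ℝ) ≤ ((k : ℕ) : ℝ) := Nat.cast_nonneg _
        linarith)).const_mul _
  have hgn : ∀ n, ∀ t ∈ Ioc a b, (φ t - φ a) ^ γ * gn n t = (P n).eval (φ t - φ a) := by
    intro n t ht
    rw [Polynomial.eval_eq_sum_range, Finset.mul_sum, Finset.sum_range]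
    refine Finset.sum_congr rfl fun k _ => ?_
    have : 0 < Real.Gamma ((k : ℕ) - γ + 1) := Real.Gamma_pos_of_pos (by
      have : (0 : ℝ) ≤ ((k : ℕ) : ℝ) := Nat.cast_nonneg _
      linarith)
    rw [mul_left_comm, H.rpow_mul_fracPow ht, add_sub_cancel, Real.rpow_natCast]
    simp only [A]
    field_simp
  have hclose : ∀ n, ∀ t ∈ Ioc a b,
      |(φ t - φ a) ^ γ * gn n t - (φ t - φ a) ^ γ * g t| ≤ 1 / ((n : ℝ) + 1) := by
    intro n t ht
    rw [hgn n t ht, ← hFg t ht]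
    exact (hP n t (Ioc_subset_Icc_self ht)).le
  have hcl := fun n => H.hasClassicalHilfer_sum hμ₁ hμ₂ hν₀ hν₁ p q _ (A n)
    (h := fun t => p * fracPow φ a (-γ) t + q * fracPow φ a (1 - γ) t + rlInt φ a b μ (gn n) t)
    (fun t _ => rfl)
  have hsmall : ∀ C : ℝ, ∀ ε > 0, ∀ᶠ n : ℕ in atTop, 1 / ((n : ℝ) + 1) * C < ε := by
    intro C ε hε
    have h0 := (tendsto_one_div_add_atTop_nhds_zero_nat (𝕜 := ℝ)).mul_const C
    rw [zero_mul] at h0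
    exact h0.eventually_lt_const hε
  refine ⟨_, fun n => (hcl n).1, ?_, ?_⟩
  · refine Metric.tendstoUniformlyOn_iff.2 fun ε hε => ?_
    filter_upwards [hsmall (Real.Gamma (1 - γ) * ((φ b - φ a) ^ μ / Real.Gamma (μ - γ + 1))) ε hε]
      with n hn t ht
    refine lt_of_le_of_lt ?_ hn
    have h0 := H.sub_pos_of_mem ht
    have h1 := H.abs_rlInt_sub_le hγ₁ hμ₁.le (hgni n) hgi
      (fun s hs => H.abs_sub_le_of_weighted hs (hclose n s hs)) ht
    rw [dist_comm, Real.dist_eq, ← mul_sub, add_sub_add_left_eq_sub, abs_mul,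
      abs_of_pos (Real.rpow_pos_of_pos h0 _)]
    refine (mul_le_mul_of_nonneg_left h1 (Real.rpow_pos_of_pos h0 _).le).trans ?_
    rw [mul_left_comm, mul_left_comm _ (Real.Gamma _), H.rpow_mul_fracPow ht, add_sub_cancel]
    have hΓ₁ := Real.Gamma_pos_of_pos (by linarith : 0 < 1 - γ)
    have hΓ₂ := Real.Gamma_pos_of_pos (by linarith : 0 < μ - γ + 1)
    have := Real.rpow_le_rpow h0.le (H.sub_le le_rfl ht.1.le ht.2) (by linarith : 0 ≤ μ)
    gcongr
  · refine Metric.tendstoUniformlyOn_iff.2 fun ε hε => ?_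
    filter_upwards [hsmall 1 ε hε] with n hn t ht
    rw [mul_one] at hn
    rw [(hcl n).2 t ht, dist_comm, Real.dist_eq]
    exact (hclose n t ht).trans_lt hn

end IsTimeChange

/-! ### Grönwall inequality, existence and stability -/

theorem summable_mittagLeffler {μ z : ℝ} (hμ : 1 ≤ μ) (hz : 0 ≤ z) :
    Summable fun k : ℕ => z ^ k / Real.Gamma (k * μ + 1) := by
  have hk0 : ∀ k : ℕ, (0 : ℝ) ≤ k := fun k => Nat.cast_nonneg _
  refine (Real.summable_pow_div_factorial z).of_nonneg_of_le (fun k => ?_) fun k => ?_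
  · have := Real.Gamma_pos_of_pos
      (by linarith [mul_nonneg (hk0 k) (by linarith : 0 ≤ μ)] : 0 < (k : ℝ) * μ + 1)
    positivity
  · refine div_le_div_of_nonneg_left (pow_nonneg hz k) (by positivity) ?_
    rw [← Real.Gamma_nat_eq_factorial]
    rcases Nat.eq_zero_or_pos k with rfl | hk
    · simp
    · have h1 : (1 : ℝ) ≤ k := by exact_mod_cast hk
      have h2 : (k : ℝ) ≤ k * μ := le_mul_of_one_le_right (hk0 k) hμ
      -- `Γ` is increasing on `[2, ∞)`.
      exact Real.Gamma_strictMonoOn_Ici.monotoneOn (mem_Ici.2 (by linarith))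
        (mem_Ici.2 (by linarith)) (by linarith)

theorem mittagLeffler_pos {μ z : ℝ} (hμ : 1 ≤ μ) (hz : 0 ≤ z) : 0 < mittagLeffler μ z := by
  refine (summable_mittagLeffler hμ hz).tsum_pos (fun k => ?_) 0 (by simp)
  have := Real.Gamma_pos_of_pos (by positivity : 0 < (k : ℝ) * μ + 1)
  positivity

namespace IsTimeChange

variable {φ : ℝ → ℝ} {a b : ℝ} (H : IsTimeChange φ a b)
include H

/-- A fractional Grönwall inequality, proved by iterating the hypothesis: each iteration produces
one more term of the Mittag-Leffler series and makes the remainder smaller. -/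
theorem le_mul_mittagLeffler {μ A k : ℝ} (hμ : 1 ≤ μ) (hA : 0 ≤ A) (hk : 0 ≤ k) {w χ : ℝ → ℝ}
    (hw : ContinuousOn w (Icc a b)) (hw₀ : ∀ t ∈ Icc a b, 0 ≤ w t)
    (hχ : MonotoneOn χ (Icc a b)) (hχ₀ : ∀ t ∈ Icc a b, 0 ≤ χ t)
    (h : ∀ t ∈ Ioc a b, w t ≤ A * χ t + k * rlInt φ a b μ w t) :
    ∀ t ∈ Ioc a b, w t ≤ A * χ t * mittagLeffler μ (k * (φ b - φ a) ^ μ) := by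
  obtain ⟨M, hM⟩ := isCompact_Icc.exists_bound_of_continuousOn hw
  have hμ0 : 0 < μ := by linarith
  have hj0 : ∀ j : ℕ, 0 ≤ (j : ℝ) * μ := fun j => mul_nonneg (Nat.cast_nonneg _) hμ0.le
  have hM0 : 0 ≤ M := (norm_nonneg _).trans (hM b ⟨H.lt.le, le_rfl⟩)
  have hfp : ∀ (j : ℕ) (t : ℝ), t ∈ Ioc a b → 0 ≤ fracPow φ a (j * μ) t := fun j t ht =>
    div_nonneg (Real.rpow_nonneg (H.sub_pos_of_mem ht).le _)
      (Real.Gamma_pos_of_pos (by linarith [hj0 j])).le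
  have iter : ∀ n : ℕ, ∀ t ∈ Ioc a b, w t ≤
      A * χ t * ∑ j ∈ Finset.range n, k ^ j * fracPow φ a (j * μ) t +
        M * k ^ n * fracPow φ a (n * μ) t := by
    intro n
    induction n with
    | zero =>
      intro t ht
      have := (le_abs_self _).trans (hM t (Ioc_subset_Icc_self ht))
      simpa [fracPow] using this
    | succ n ih =>
      intro t ht
      have ht' := Ioc_subset_Icc_self ht
      have hiS : IntegrableOn
          (fun s => ∑ j ∈ Finset.range n, k ^ j * fracPow φ a (j * μ) s) (Ioc a b) :=
        integrable_finsetSum _ fun j _ =>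
          (H.integrableOn_fracPow (by linarith [hj0 j])).const_mul _
      have hi1 := hiS.const_mul (A * χ t)
      have hi2 := (H.integrableOn_fracPow (by linarith [hj0 n] : -1 < n * μ)).const_mul (M * k ^ n)
      have h1 := (le_abs_self _).trans (H.abs_rlInt_le (g := w)
        (G := fun s => A * χ t * ∑ j ∈ Finset.range n, k ^ j * fracPow φ a (j * μ) s +
          M * k ^ n * fracPow φ a (n * μ) s) ht' hμ0
        (H.integrableOn_kernel_mul ht' hμ (hi1.add hi2)) fun s hs => by
          have hs' : s ∈ Ioc a b := ⟨hs.1, hs.2.trans ht.2⟩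
          rw [abs_of_nonneg (hw₀ s (Ioc_subset_Icc_self hs'))]
          refine (ih s hs').trans ?_
          have := hχ (Ioc_subset_Icc_self hs') ht' hs.2
          have := Finset.sum_nonneg fun j (_ : j ∈ Finset.range n) =>
            mul_nonneg (pow_nonneg hk j) (hfp j s hs')
          gcongr)
      rw [H.rlInt_add ht' hμ hi1 hi2, rlInt_const_mul, rlInt_const_mul,
        H.rlInt_sum_fracPow _ _ _ ht hμ0.le fun j _ => by linarith [hj0 j],
        H.rlInt_fracPow ht hμ0.le (by linarith [hj0 n])] at h1
      refine (h t ht).trans ((add_le_add_right (mul_le_mul_of_nonneg_left h1 hk) _).trans_eq ?_)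
      rw [Finset.sum_range_succ']
      have e : ∀ j : ℕ, ((j + 1 : ℕ) : ℝ) * μ = j * μ + μ := fun j => by push_cast; ring
      have e0 : fracPow φ a (((0 : ℕ) : ℝ) * μ) t = 1 := by simp [fracPow]
      have e1 : ∑ j ∈ Finset.range n, k ^ (j + 1) * fracPow φ a (j * μ + μ) t =
          k * ∑ j ∈ Finset.range n, k ^ j * fracPow φ a (j * μ + μ) t := by
        rw [Finset.mul_sum]
        exact Finset.sum_congr rfl fun j _ => by ring
      simp only [e, e0, e1]
      ring
  intro t ht
  have hT := H.sub_nonneg le_rfl H.lt.le le_rfl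
  have hz : 0 ≤ k * (φ b - φ a) ^ μ := mul_nonneg hk (Real.rpow_nonneg hT _)
  have hsum := summable_mittagLeffler hμ hz
  have hterm : ∀ j : ℕ, k ^ j * fracPow φ a (j * μ) t ≤
      (k * (φ b - φ a) ^ μ) ^ j / Real.Gamma (j * μ + 1) := by
    intro j
    have hΓ := Real.Gamma_pos_of_pos (by linarith [hj0 j] : 0 < (j : ℝ) * μ + 1)
    have h1 := Real.rpow_le_rpow (H.sub_pos_of_mem ht).le (H.sub_le le_rfl ht.1.le ht.2) (hj0 j)
    rw [mul_pow, ← Real.rpow_mul_natCast hT, mul_comm μ, fracPow, mul_div_assoc]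
    gcongr
  have hlim := ((hsum.tendsto_atTop_zero).const_mul M).const_add
    (A * χ t * mittagLeffler μ (k * (φ b - φ a) ^ μ))
  rw [mul_zero, add_zero] at hlim
  refine ge_of_tendsto' hlim fun n => (iter n t ht).trans ?_
  have hAχ := mul_nonneg hA (hχ₀ t (Ioc_subset_Icc_self ht))
  refine add_le_add (mul_le_mul_of_nonneg_left ?_ hAχ) ?_
  · refine (Finset.sum_le_sum fun j _ => hterm j).trans (hsum.sum_le_tsum _ fun j _ => ?_)
    have hΓ := Real.Gamma_pos_of_pos (by linarith [hj0 j] : 0 < (j : ℝ) * μ + 1)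
    positivity
  · rw [mul_assoc]
    exact mul_le_mul_of_nonneg_left (hterm n) hM0

/-- The weight `exp (θ (φ - φ(a)) ^ (1 - γ))`, adapted to the singularity of order `γ` of the
functions in the space: its `φ`-derivative is `θ (1 - γ)` times
`(φ - φ(a)) ^ (-γ)` times the weight. Hence the fractional integral of order `μ ≥ 1` gains a
factor `1 / θ`. -/
theorem rlInt_rpow_mul_exp_le {γ μ θ t : ℝ} (hγ : γ < 1) (hμ : 1 ≤ μ) (hθ : 0 < θ)
    (ht : t ∈ Ioc a b) :
    rlInt φ a b μ
        (fun s => (φ s - φ a) ^ (-γ) * Real.exp (θ * (φ s - φ a) ^ (1 - γ))) t ≤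
      (φ b - φ a) ^ (μ - 1) / (Real.Gamma μ * (1 - γ)) / θ *
        Real.exp (θ * (φ t - φ a) ^ (1 - γ)) := by
  have hμ0 : 0 < μ := by linarith
  have hΓ := Real.Gamma_pos_of_pos hμ0
  have hγ1 : 0 < 1 - γ := by linarith
  set w : ℝ → ℝ := fun s => Real.exp (θ * (φ s - φ a) ^ (1 - γ)) with hw
  have hwc : ContinuousOn w (Icc a b) :=
    (continuousOn_const.mul (H.cont_sub.rpow_const fun _ _ => Or.inr hγ1.le)).rexp
  have hki : IntegrableOn (fun s => (φ s - φ a) ^ (-γ) * w s) (Ioc a b) :=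
    H.integrableOn_of_memC hγ ⟨w, hwc, fun s hs => by
      rw [← mul_assoc, mul_comm ((φ s - φ a) ^ γ), H.rpow_neg_mul_rpow hs, one_mul]⟩
  have hti : IntegrableOn (fun s => dphi φ a b s * ((φ s - φ a) ^ (-γ) * w s)) (Ioc a t) :=
    (H.integrableOn_dphi_mul hki).mono_set (Ioc_subset_Ioc_right ht.2)
  have hFTC : ∫ s in Ioc a t, dphi φ a b s * ((φ s - φ a) ^ (-γ) * w s) ≤ w t / (θ * (1 - γ)) := by
    rw [← intervalIntegral.integral_of_le ht.1.le,
      intervalIntegral.integral_eq_sub_of_hasDerivAt_of_le (f := fun s => w s / (θ * (1 - γ)))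
        ht.1.le ((hwc.mono (Icc_subset_Icc_right ht.2)).div_const _) ?_
        ((intervalIntegrable_iff_integrableOn_Ioc_of_le ht.1.le).2 hti)]
    · have : 0 < w a / (θ * (1 - γ)) := div_pos (Real.exp_pos _) (mul_pos hθ hγ1)
      linarith
    · intro s hs
      have hs' : s ∈ Ioc a b := ⟨hs.1, hs.2.le.trans ht.2⟩
      have hd := (H.deriv s (Ioc_subset_Icc_self hs')).hasDerivAt
        (Icc_mem_nhds hs.1 (hs.2.trans_le ht.2))
      have h1 := ((((hd.sub_const (φ a)).rpow_const (p := 1 - γ)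
        (Or.inl (H.sub_pos_of_mem hs').ne')).const_mul θ).exp).div_const (θ * (1 - γ))
      refine h1.congr_deriv ?_
      rw [show 1 - γ - 1 = -γ by ring, hw]
      field_simp
  rw [rlInt_of_pos hμ0 ht.1.le]
  have hle : ∫ s in Ioc a t, dphi φ a b s * (φ t - φ s) ^ (μ - 1) * ((φ s - φ a) ^ (-γ) * w s) ≤
      (φ b - φ a) ^ (μ - 1) *
        ∫ s in Ioc a t, dphi φ a b s * ((φ s - φ a) ^ (-γ) * w s) := by
    rw [← integral_const_mul]
    refine setIntegral_mono_on (H.integrableOn_kernel_mul (Ioc_subset_Icc_self ht) hμ hki)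
      (hti.const_mul _) measurableSet_Ioc fun s hs => ?_
    have hs' : s ∈ Ioc a b := ⟨hs.1, hs.2.trans ht.2⟩
    have h1 := (H.pos s (Ioc_subset_Icc_self hs')).le
    have h2 := Real.rpow_le_rpow (H.sub_nonneg hs.1.le hs.2 ht.2) (H.sub_le hs.1.le hs.2 ht.2)
      (by linarith : 0 ≤ μ - 1)
    have h3 : 0 ≤ (φ s - φ a) ^ (-γ) * w s :=
      mul_nonneg (Real.rpow_nonneg (H.sub_pos_of_mem hs').le _) (Real.exp_pos _).le
    calc _ = dphi φ a b s * ((φ s - φ a) ^ (-γ) * w s) * (φ t - φ s) ^ (μ - 1) := by ring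
      _ ≤ dphi φ a b s * ((φ s - φ a) ^ (-γ) * w s) * (φ b - φ a) ^ (μ - 1) :=
        mul_le_mul_of_nonneg_left h2 (mul_nonneg h1 h3)
      _ = _ := by ring
  have hT := Real.rpow_nonneg (H.sub_nonneg le_rfl H.lt.le le_rfl) (μ - 1)
  calc _ ≤ 1 / Real.Gamma μ * ((φ b - φ a) ^ (μ - 1) * (w t / (θ * (1 - γ)))) := by
        gcongr
        exact hle.trans (mul_le_mul_of_nonneg_left hFTC hT)
    _ = _ := by
        rw [hw]
        field_simp

end IsTimeChange

/-- The initial value problem for the implicit equation, with the singular part of the solution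
prescribed, has a solution. -/
theorem HypH1.exists_eq {φ : ℝ → ℝ} {a b μ ν K L : ℝ} {f : ℝ → ℝ → ℝ → ℝ}
    (hf : HypH1 φ a b μ ν f K L) (H : IsTimeChange φ a b)
    (hμ₁ : 1 < μ) (hμ₂ : μ < 2) (hν₀ : 0 ≤ ν) (hν₁ : ν ≤ 1) (p q : ℝ) :
    ∃ g : ℝ → ℝ, MemC φ a b (2 - xi μ ν) g ∧ ∀ t ∈ Ioc a b,
      g t = f t (p * fracPow φ a (-(2 - xi μ ν)) t + q * fracPow φ a (1 - (2 - xi μ ν)) t +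
        rlInt φ a b μ g t) (g t) := by
  have hγ₀ : 0 ≤ 2 - xi μ ν := by unfold xi; nlinarith
  have hγ₁ : 2 - xi μ ν < 1 := by unfold xi; nlinarith
  have hmaps := fun g hg =>
    hf.mapsTo _ g (H.isHilferDeriv_fracPow_add_rlInt hμ₁ hμ₂ hν₀ hν₁ p q hg) hg
  set γ := 2 - xi μ ν with hγ
  have hL := hf.L_lt_one
  have hL0 := hf.L_pos
  have hK := hf.K_pos
  have hT := H.sub_nonneg le_rfl H.lt.le le_rfl
  have hΓ := Real.Gamma_pos_of_pos (by linarith : 0 < μ)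
  have hγ1 : 0 < 1 - γ := by linarith
  -- The contraction constant is `C / θ + L`.
  set C := K * (φ b - φ a) ^ γ * ((φ b - φ a) ^ (μ - 1) / (Real.Gamma μ * (1 - γ))) with hC
  have hC0 : 0 ≤ C := by positivity
  set θ := C / (1 - L) + 1 with hθ'
  have hθ : 0 < θ := by
    have : 0 ≤ C / (1 - L) := div_nonneg hC0 (by linarith)
    linarith
  have hκ : C / θ + L < 1 := by
    have h1 : C < θ * (1 - L) := by
      rw [hθ', add_mul, div_mul_cancel₀ _ (by linarith : (1 - L) ≠ 0)]
      linarith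
    have : C / θ < 1 - L := by
      rw [div_lt_iff₀ hθ]
      linarith
    linarith
  have hκ0 : 0 ≤ C / θ + L := by positivity
  set w : ℝ → ℝ := fun s => Real.exp (θ * (φ s - φ a) ^ (1 - γ)) with hw
  have hw0 : ∀ t, 0 < w t := fun t => Real.exp_pos _
  have hwc : ContinuousOn w (Icc a b) :=
    (continuousOn_const.mul (H.cont_sub.rpow_const fun _ _ => Or.inr hγ1.le)).rexp
  -- A continuous function `x` on `J` encodes the element `(φ - φ(a)) ^ (-γ) * w * x` of the space.
  let G : C(Icc a b, ℝ) → ℝ → ℝ := fun x t =>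
    (φ t - φ a) ^ (-γ) * w t * IccExtend H.lt.le x t
  have hGmem : ∀ x, MemC φ a b γ (G x) := fun x =>
    ⟨fun t => w t * IccExtend H.lt.le x t, hwc.mul x.continuous.Icc_extend'.continuousOn,
      fun t ht => by
        simp only [G]
        rw [← mul_assoc, ← mul_assoc, mul_comm ((φ t - φ a) ^ γ), H.rpow_neg_mul_rpow ht, one_mul]⟩
  choose F hF hFeq using fun x => hmaps (G x) (hGmem x)
  let Φ : C(Icc a b, ℝ) → C(Icc a b, ℝ) := fun x =>
    ⟨(Icc a b).domRestrict fun t => F x t / w t,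
      ((hF x).div hwc fun t _ => (hw0 t).ne').domRestrict⟩
  have hlip : LipschitzWith ⟨C / θ + L, hκ0⟩ Φ := by
    refine LipschitzWith.of_dist_le_mul fun x x' => ?_
    change dist (Φ x) (Φ x') ≤ (C / θ + L) * dist x x'
    set D := dist x x' with hD
    have hD0 : 0 ≤ D := dist_nonneg
    have hGG : ∀ t ∈ Ioc a b, |G x t - G x' t| ≤ D * ((φ t - φ a) ^ (-γ) * w t) := by
      intro t ht
      have h1 : |IccExtend H.lt.le x t - IccExtend H.lt.le x' t| ≤ D :=
        ContinuousMap.dist_apply_le_dist (f := x) (g := x') _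
      have h2 : 0 < (φ t - φ a) ^ (-γ) * w t :=
        mul_pos (Real.rpow_pos_of_pos (H.sub_pos_of_mem ht) _) (hw0 t)
      simp only [G]
      rw [← mul_sub, abs_mul, abs_of_pos h2, mul_comm]
      exact mul_le_mul_of_nonneg_right h1 h2.le
    have key : ∀ t ∈ Ioc a b, |F x t / w t - F x' t / w t| ≤ (C / θ + L) * D := by
      intro t ht
      have h0 := H.sub_pos_of_mem ht
      have ht' := Ioc_subset_Icc_self ht
      have hU : 0 < (φ t - φ a) ^ γ := Real.rpow_pos_of_pos h0 _
      have hI : |rlInt φ a b μ (G x) t - rlInt φ a b μ (G x') t| ≤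
          D * ((φ b - φ a) ^ (μ - 1) / (Real.Gamma μ * (1 - γ)) / θ * w t) := by
        rw [← H.rlInt_sub ht' hμ₁.le (H.integrableOn_of_memC hγ₁ (hGmem x))
          (H.integrableOn_of_memC hγ₁ (hGmem x'))]
        refine (H.abs_rlInt_le (G := fun s => D * ((φ s - φ a) ^ (-γ) * w s)) ht' (by linarith)
          (H.integrableOn_kernel_mul ht' hμ₁.le ?_)
          fun s hs => hGG s ⟨hs.1, hs.2.trans ht.2⟩).trans ?_
        · refine IntegrableOn.congr_fun ((H.integrableOn_of_memC hγ₁ (hGmem 1)).const_mul D)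
            (fun s _ => ?_) measurableSet_Ioc
          simp [G, IccExtend]
        · rw [IsTimeChange.rlInt_const_mul]
          exact mul_le_mul_of_nonneg_left (H.rlInt_rpow_mul_exp_le hγ₁ hμ₁.le hθ ht) hD0
      have hff := hf.lipschitz t ht
        (p * fracPow φ a (-γ) t + q * fracPow φ a (1 - γ) t + rlInt φ a b μ (G x) t)
        (p * fracPow φ a (-γ) t + q * fracPow φ a (1 - γ) t + rlInt φ a b μ (G x') t)
        (G x t) (G x' t)
      rw [add_sub_add_left_eq_sub] at hff
      rw [← sub_div, hFeq x t ht, hFeq x' t ht, ← mul_sub, abs_div, abs_mul, abs_of_pos hU,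
        abs_of_pos (hw0 t), div_le_iff₀ (hw0 t)]
      have hUT : (φ t - φ a) ^ γ ≤ (φ b - φ a) ^ γ :=
        Real.rpow_le_rpow h0.le (H.sub_le le_rfl ht.1.le ht.2) hγ₀
      have hR : 0 ≤ D * ((φ b - φ a) ^ (μ - 1) / (Real.Gamma μ * (1 - γ)) / θ * w t) :=
        (abs_nonneg _).trans hI
      calc _ ≤ (φ t - φ a) ^ γ *
            (K * (D * ((φ b - φ a) ^ (μ - 1) / (Real.Gamma μ * (1 - γ)) / θ * w t)) +
              L * (D * ((φ t - φ a) ^ (-γ) * w t))) :=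
            mul_le_mul_of_nonneg_left (hff.trans (add_le_add
              (mul_le_mul_of_nonneg_left hI hK.le)
              (mul_le_mul_of_nonneg_left (hGG t ht) hL0.le))) hU.le
        _ = (φ t - φ a) ^ γ *
              (K * (D * ((φ b - φ a) ^ (μ - 1) / (Real.Gamma μ * (1 - γ)) / θ * w t))) +
              L * D * w t * ((φ t - φ a) ^ (-γ) * (φ t - φ a) ^ γ) := by ring
        _ ≤ (φ b - φ a) ^ γ *
              (K * (D * ((φ b - φ a) ^ (μ - 1) / (Real.Gamma μ * (1 - γ)) / θ * w t))) +
              L * D * w t := by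
            rw [H.rpow_neg_mul_rpow ht, mul_one]
            gcongr
        _ = _ := by rw [hC]; ring
    refine (ContinuousMap.dist_le (mul_nonneg hκ0 hD0)).2 fun t => ?_
    have hcl : closure (Ioc a b) = Icc a b := closure_Ioc H.lt.ne
    have hcont : ∀ x, ContinuousOn (fun t => F x t / w t) (closure (Ioc a b)) := fun x => by
      rw [hcl]
      exact (hF x).div hwc fun t _ => (hw0 t).ne'
    exact le_on_closure key ((hcont x).sub (hcont x')).abs continuousOn_const (by rw [hcl]; exact t.2)
  have hcontr : ContractingWith ⟨C / θ + L, hκ0⟩ Φ := ⟨hκ, hlip⟩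
  set x := ContractingWith.fixedPoint Φ hcontr with hx
  have hfix : Φ x = x := hcontr.fixedPoint_isFixedPt
  refine ⟨G x, hGmem x, fun t ht => ?_⟩
  have h1 : F x t / w t = x ⟨t, Ioc_subset_Icc_self ht⟩ :=
    congrArg (fun y : C(Icc a b, ℝ) => y ⟨t, Ioc_subset_Icc_self ht⟩) hfix
  have h2 : IccExtend H.lt.le x t = x ⟨t, Ioc_subset_Icc_self ht⟩ :=
    IccExtend_of_mem _ _ (Ioc_subset_Icc_self ht)
  have h3 : G x t = (φ t - φ a) ^ (-γ) * F x t := by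
    simp only [G]
    rw [h2, ← h1]
    have := (hw0 t).ne'
    field_simp
  rw [hFeq x t ht, ← mul_assoc, H.rpow_neg_mul_rpow ht, one_mul] at h3
  exact h3

/-- Stability: the solution near an approximate solution `z` is the one with the same singular
part as `z`. -/
theorem IsApproxSolution.exists_isSolution {φ : ℝ → ℝ} {a b μ ν K L : ℝ} {f : ℝ → ℝ → ℝ → ℝ}
    (H : IsTimeChange φ a b) (hf : HypH1 φ a b μ ν f K L)
    (hμ₁ : 1 < μ) (hμ₂ : μ < 2) (hν₀ : 0 ≤ ν) (hν₁ : ν ≤ 1) {χ : ℝ → ℝ}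
    (hχ_cont : ContinuousOn χ (Icc a b)) (hχ_mono : MonotoneOn χ (Icc a b))
    (hχ_nonneg : ∀ t ∈ Icc a b, 0 ≤ χ t) {Kstar : ℝ} (hKstar : 0 < Kstar)
    (hχ : ∀ t ∈ Icc a b, rlInt φ a b μ χ t ≤ Kstar * χ t) {ε : ℝ} (hε : 0 < ε) {z : ℝ → ℝ}
    (hz : IsApproxSolution φ a b μ ν f (fun t => ε * χ t) z) :
    ∃ y : ℝ → ℝ, IsSolution φ a b μ ν f y ∧
      ∀ t ∈ Ioc a b, |(φ t - φ a) ^ (2 - xi μ ν) * (z t - y t)| ≤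
        ε * (Kstar / (1 - L) * (φ b - φ a) ^ (2 - xi μ ν) *
          mittagLeffler μ (K / (1 - L) * (φ b - φ a) ^ μ)) * χ t := by
  obtain ⟨g, hzg, hg⟩ := hz
  obtain ⟨hgi, p, q, hzr⟩ := hzg.integrableOn_and_repr H hμ₁ hμ₂ hν₀ hν₁
  obtain ⟨k, hkm, hk⟩ := hf.exists_eq H hμ₁ hμ₂ hν₀ hν₁ p q
  have hγ₀ : 0 ≤ 2 - xi μ ν := by unfold xi; nlinarith
  have hγ₁ : 2 - xi μ ν < 1 := by unfold xi; nlinarith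
  refine ⟨_, ⟨k, H.isHilferDeriv_fracPow_add_rlInt hμ₁ hμ₂ hν₀ hν₁ p q hkm, hk⟩, ?_⟩
  set γ := 2 - xi μ ν with hγ
  have hki := H.integrableOn_of_memC hγ₁ hkm
  have hL : 0 < 1 - L := by linarith [hf.L_lt_one]
  have hK := hf.K_pos
  set w : ℝ → ℝ := fun t => |rlInt φ a b μ g t - rlInt φ a b μ k t| with hw
  have hwc : ContinuousOn w (Icc a b) :=
    ((H.continuousOn_rlInt hμ₁ hgi).sub (H.continuousOn_rlInt hμ₁ hki)).abs
  have hχi : IntegrableOn χ (Ioc a b) :=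
    (hχ_cont.integrableOn_Icc).mono_set Ioc_subset_Icc_self
  have hwi : IntegrableOn w (Ioc a b) := (hwc.integrableOn_Icc).mono_set Ioc_subset_Icc_self
  -- The Lipschitz condition in the last variable lets the derivatives be compared.
  have hgk : ∀ t ∈ Ioc a b, |g t - k t| ≤ ε / (1 - L) * χ t + K / (1 - L) * w t := by
    intro t ht
    have h1 := hg t ht
    have h2 := hf.lipschitz t ht (z t) (p * fracPow φ a (-γ) t + q * fracPow φ a (1 - γ) t +
      rlInt φ a b μ k t) (g t) (k t)
    rw [← hk t ht] at h2
    have h3 : z t - (p * fracPow φ a (-γ) t + q * fracPow φ a (1 - γ) t +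
        rlInt φ a b μ k t) = rlInt φ a b μ g t - rlInt φ a b μ k t := by
      rw [hzr t ht]; ring
    rw [h3] at h2
    have h4 := abs_sub_le (g t) (f t (z t) (g t)) (k t)
    have h5 : |g t - k t| * (1 - L) ≤ ε * χ t + K * w t := by
      simp only [hw]
      linarith
    rw [← le_div_iff₀ hL] at h5
    refine h5.trans_eq ?_
    ring
  have hineq : ∀ t ∈ Ioc a b,
      w t ≤ ε * Kstar / (1 - L) * χ t + K / (1 - L) * rlInt φ a b μ w t := by
    intro t ht
    have ht' := Ioc_subset_Icc_self ht
    have hi1 := hχi.const_mul (ε / (1 - L))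
    have hi2 := hwi.const_mul (K / (1 - L))
    have h1 := H.abs_rlInt_le (g := fun s => g s - k s) ht' (by linarith)
      (H.integrableOn_kernel_mul ht' hμ₁.le (hi1.add hi2))
      fun s hs => hgk s ⟨hs.1, hs.2.trans ht.2⟩
    rw [H.rlInt_sub ht' hμ₁.le hgi hki] at h1
    refine h1.trans ?_
    refine (H.rlInt_add ht' hμ₁.le hi1 hi2).trans_le ?_
    rw [IsTimeChange.rlInt_const_mul, IsTimeChange.rlInt_const_mul]
    have h2 := mul_le_mul_of_nonneg_left (hχ t ht') (div_nonneg hε.le hL.le)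
    calc _ ≤ ε / (1 - L) * (Kstar * χ t) + K / (1 - L) * rlInt φ a b μ w t := by gcongr
      _ = _ := by ring
  intro t ht
  have hmain := H.le_mul_mittagLeffler hμ₁.le (by positivity : 0 ≤ ε * Kstar / (1 - L))
    (by positivity : 0 ≤ K / (1 - L)) hwc (fun _ _ => abs_nonneg _) hχ_mono hχ_nonneg hineq t ht
  have h0 := H.sub_pos_of_mem ht
  have hU : 0 < (φ t - φ a) ^ γ := Real.rpow_pos_of_pos h0 _
  have hUT : (φ t - φ a) ^ γ ≤ (φ b - φ a) ^ γ :=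
    Real.rpow_le_rpow h0.le (H.sub_le le_rfl ht.1.le ht.2) hγ₀
  rw [hzr t ht, add_sub_add_left_eq_sub, abs_mul, abs_of_pos hU]
  calc _ ≤ (φ b - φ a) ^ γ * (ε * Kstar / (1 - L) * χ t *
        mittagLeffler μ (K / (1 - L) * (φ b - φ a) ^ μ)) :=
        mul_le_mul hUT hmain (abs_nonneg _) (hU.le.trans hUT)
    _ = _ := by ring

end PhiHilfer

theorem theorem5p2
    (a b : ℝ) (ha : 0 ≤ a) (hab : a < b)
    (φ : ℝ → ℝ) (hφ : ContDiffOn ℝ 1 φ (Icc a b)) (hφ_mono : StrictMonoOn φ (Icc a b))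
    (hφ' : ∀ t ∈ Icc a b, PhiHilfer.dphi φ a b t ≠ 0)
    (μ ν : ℝ) (hμ₁ : 1 < μ) (hμ₂ : μ < 2) (hν₀ : 0 ≤ ν) (hν₁ : ν ≤ 1)
    (m : ℕ) (lam δ τ : Fin m → ℝ) (hδ : ∀ i, 0 < δ i)
    (hτ_mono : StrictMono τ) (hτ : ∀ i, τ i ∈ Icc a b)
    (hΛ : PhiHilfer.Lam φ a b μ ν lam δ τ ≠ 0)
    (f : ℝ → ℝ → ℝ → ℝ) (K L : ℝ) (hH1 : PhiHilfer.HypH1 φ a b μ ν f K L)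
    (hσ : PhiHilfer.sigm φ a b μ ν lam δ τ K L < 1)
    (χ : ℝ → ℝ) (hχ_cont : ContinuousOn χ (Icc a b)) (hχ_mono : MonotoneOn χ (Icc a b))
    (hχ_nonneg : ∀ t ∈ Icc a b, 0 ≤ χ t)
    (Kstar : ℝ) (hKstar : 0 < Kstar)
    (hχ : ∀ t ∈ Icc a b, PhiHilfer.rlInt φ a b μ χ t ≤ Kstar * χ t) :
    PhiHilfer.UHRStableWith φ a b μ ν f χ
      (Kstar / (1 - L) * (φ b - φ a) ^ (2 - PhiHilfer.xi μ ν) *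
        PhiHilfer.mittagLeffler μ (K / (1 - L) * (φ b - φ a) ^ μ)) ∧
    PhiHilfer.GenUHRStableWith φ a b μ ν f χ
      (Kstar / (1 - L) * (φ b - φ a) ^ (2 - PhiHilfer.xi μ ν) *
        PhiHilfer.mittagLeffler μ (K / (1 - L) * (φ b - φ a) ^ μ)) := by
  have H := PhiHilfer.isTimeChange_of_contDiffOn hab hφ hφ_mono hφ'
  have hT := H.sub_pos le_rfl hab le_rfl
  have hL : 0 < 1 - L := by linarith [hH1.L_lt_one]
  have hK := hH1.K_pos
  have hE := PhiHilfer.mittagLeffler_pos hμ₁.le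
    (by positivity : 0 ≤ K / (1 - L) * (φ b - φ a) ^ μ)
  refine ⟨⟨by positivity, fun ε hε z hz =>
    hz.exists_isSolution H hH1 hμ₁ hμ₂ hν₀ hν₁ hχ_cont hχ_mono hχ_nonneg hKstar hχ hε⟩,
    ⟨by positivity, fun z hz => ?_⟩⟩
  have hz' : PhiHilfer.IsApproxSolution φ a b μ ν f (fun t => 1 * χ t) z := by
    simpa only [one_mul] using hz
  simpa only [one_mul] using
    hz'.exists_isSolution H hH1 hμ₁ hμ₂ hν₀ hν₁ hχ_cont hχ_mono hχ_nonneg hKstar hχ one_pos
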